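/- Let $V$ be a countable set, and let $(V,b,c,m)$ be a weighted graph: $m:V\to(0,\infty)$, $c:V\to[0,\infty)$, and $b:V\times V\to[0,\infty)$ symmetric with $b(x,x)=0$ for all $x$. Write $x\sim y$ if $b(x,y)>0$, and assume that the graph is connected (any two vertices are joined by a finite chain $x_0\sim x_1\sim\dots\sim x_n$) and locally finite (every vertex has only finitely many neighbors). Let $d$ be the combinatorial graph distance and $S_r(x_0)=\{x : d(x,x_0)=r\}$ (so $S_{-1}(x_0)=\emptyset$). For $x_0\in V$ and $x\in S_r(x_0)$ put $\kappa_\pm(x)=\frac1{m(x)}\sum_{y\in S_{r\pm1}(x_0)}b(x,y)$ (the outer and inner curvatures), and let $q=c/m$. The weighted graph is called weakly spherically symmetric if there is a vertex $x_0$ such that $\kappa_+$, $\kappa_-$ and $q$ depend only on the distance to $x_0$. Let $\ell^2(V,m)$ be the real Hilbert space of functions $f:V\to\mathbb R$ with $\sum_x f(x)^2m(x)<\infty$ and inner product $\langle f,g\rangle=\sum_x f(x)g(x)m(x)$, let $$Q(f,g)=\frac12\sum_{x,y\in V}b(x,y)\,(f(x)-f(y))(g(x)-g(y))+\sum_{x\in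 V}c(x)f(x)g(x),$$ with domain $D(Q)$ the closure of the finitely supported functions in $\ell^2(V,m)$ with respect to $\langle\cdot,\cdot\rangle+Q(\cdot,\cdot)$, and let $L\ge 0$ be the self-adjoint operator on $\ell^2(V,m)$ associated with $Q$: $f\in D(L)$ and $Lf=g$ if and only if $f\in D(Q)$ and $Q(f,h)=\langle g,h\rangle$ for all $h\in D(Q)$. For $x_0\in V$ let $A$ be the averaging operator on $\ell^2(V,m)$, $$(Af)(x)=\frac1{\sum_{y\in S_r(x_0)}m(y)}\sum_{y\in S_r(x_0)}f(y)m(y)\qquad\text{for }x\in S_r(x_0).$$ The heat kernel of $L$ is called spherically symmetric if there is a vertex $x_0$ such that $A$ commutes with $e^{-tL}$ for all $t\ge0$, where $(e^{-tL})_{t\ge 0}$ is the strongly continuous semigroup generated by $-L$. Theorem. The weighted graph $(V,b,c,m)$ is weakly spherically symmetric if and only if its heat kernel is spherically symmetric. -/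

import Mathlib

open Filter Topology
open scoped NNReal

noncomputable section

/-- A connected, locally finite weighted graph `(V, b, c, m)`: symmetric edge weights `b ≥ 0` with
zero diagonal, a potential (killing term) `c ≥ 0`, and a measure `m > 0` of full support. -/
structure WeightedGraph (V : Type*) where
  /-- edge weights -/
  b : V → V → ℝ
  /-- potential -/
  c : V → ℝ
  /-- vertex measure -/
  m : V → ℝ
  b_nonneg : ∀ x y, 0 ≤ b x y
  b_symm : ∀ x y, b x y = b y x
  b_diag : ∀ x, b x x = 0
  c_nonneg : ∀ x, 0 ≤ c x
  m_pos : ∀ x, 0 < m x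
  /-- every vertex has only finitely many neighbours -/
  locallyFinite : ∀ x, {y | 0 < b x y}.Finite
  /-- any two vertices are joined by a finite sequence of successive neighbours -/
  connected : ∀ x y, Relation.ReflTransGen (fun u v => 0 < b u v) x y

namespace WeightedGraph

variable {V : Type*} (G : WeightedGraph V)

/-- The underlying combinatorial graph: `x ∼ y` iff `b x y > 0`. -/
def graph : SimpleGraph V where
  Adj x y := 0 < G.b x y
  symm := ⟨fun x y h => by rw [G.b_symm]; exact h⟩
  loopless := ⟨fun x h => by simp [G.b_diag] at h⟩

/-- The combinatorial distance. -/
def dist (x y : V) : ℕ := G.graph.dist x y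

/-- The sphere `S_r(x₀)`. -/
def sphere (x₀ : V) (r : ℕ) : Set V := {x | G.dist x₀ x = r}

/-- A function depends only on the distance to `x₀`. -/
def IsSphericallySymmetric (x₀ : V) (f : V → ℝ) : Prop :=
  ∃ g : ℕ → ℝ, ∀ r, ∀ x ∈ G.sphere x₀ r, f x = g r

/-- Outer curvature `κ₊(x) = m(x)⁻¹ ∑_{y ∈ S_{r+1}} b(x,y)` for `x ∈ S_r`. -/
def outerCurvature (x₀ x : V) : ℝ :=
  (1 / G.m x) * ∑ᶠ y ∈ G.sphere x₀ (G.dist x₀ x + 1), G.b x y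

/-- Inner curvature `κ₋(x) = m(x)⁻¹ ∑_{y ∈ S_{r-1}} b(x,y)` for `x ∈ S_r`. The sphere of
radius `-1` is empty, so the index set is written as `{y | d(x₀,y) + 1 = d(x₀,x)}`. -/
def innerCurvature (x₀ x : V) : ℝ :=
  (1 / G.m x) * ∑ᶠ y ∈ {y | G.dist x₀ y + 1 = G.dist x₀ x}, G.b x y

/-- The normalized potential `q = c / m`. -/
def normalizedPotential (x : V) : ℝ := G.c x / G.m x

/-- Weak spherical symmetry. -/
def IsWeaklySphericallySymmetric : Prop :=
  ∃ x₀ : V, G.IsSphericallySymmetric x₀ (G.outerCurvature x₀) ∧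
    G.IsSphericallySymmetric x₀ (G.innerCurvature x₀) ∧
    G.IsSphericallySymmetric x₀ G.normalizedPotential

/-! ### The Hilbert space `ℓ²(V, m)` -/

/-- Products of square summable functions are summable. -/
theorem summable_mul {f g : V → ℝ} (hf : Summable fun x => f x ^ 2 * G.m x)
    (hg : Summable fun x => g x ^ 2 * G.m x) : Summable fun x => f x * g x * G.m x := by
  refine Summable.of_norm_bounded (hf.add hg) fun x => ?_
  have hm := (G.m_pos x).le
  rw [Real.norm_eq_abs, abs_mul, abs_of_nonneg hm, ← add_mul]
  refine mul_le_mul_of_nonneg_right ?_ hm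
  rw [abs_le]
  constructor <;> nlinarith [sq_nonneg (f x + g x), sq_nonneg (f x - g x)]

/-- The space of square summable functions. -/
def ellTwo : Submodule ℝ (V → ℝ) where
  carrier := {f | Summable fun x => f x ^ 2 * G.m x}
  zero_mem' := by simp
  add_mem' {f g} hf hg := by
    have h := (hf.add hg).add ((G.summable_mul hf hg).mul_left 2)
    refine h.congr fun x => ?_
    simp only [Pi.add_apply]
    ring
  smul_mem' a f hf := by
    refine (Summable.mul_left (a ^ 2) hf).congr fun x => ?_
    simp only [Pi.smul_apply, smul_eq_mul]
    ring

/-- `ℓ²(V, m)`, as a type of its own (so that it does not inherit the product topology). -/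
def L2 : Type _ := G.ellTwo

instance : AddCommGroup G.L2 := inferInstanceAs (AddCommGroup G.ellTwo)
instance : Module ℝ G.L2 := inferInstanceAs (Module ℝ G.ellTwo)

/-- Elements of `ℓ²(V, m)` are functions on `V`. -/
instance : CoeFun G.L2 (fun _ => V → ℝ) := ⟨fun f => f.1⟩

/-- The inner product `⟨f, g⟩ = ∑ f g m`. -/
instance innerCore : InnerProductSpace.Core ℝ G.L2 where
  inner f g := ∑' x, f x * g x * G.m x
  conj_inner_symm f g := by
    simp only [conj_trivial]
    exact tsum_congr fun x => by ring
  re_inner_nonneg f := by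
    simp only [RCLike.re_to_real]
    exact tsum_nonneg fun x => mul_nonneg (mul_self_nonneg _) (G.m_pos x).le
  add_left f g h := by
    rw [← (G.summable_mul f.2 h.2).tsum_add (G.summable_mul g.2 h.2)]
    refine tsum_congr fun x => ?_
    change (f x + g x) * h x * G.m x = _
    ring
  smul_left f g a := by
    rw [conj_trivial, ← tsum_mul_left]
    refine tsum_congr fun x => ?_
    change (a * f x) * g x * G.m x = _
    ring
  definite f hf := by
    have hs := G.summable_mul f.2 f.2
    have hn : ∀ x, 0 ≤ f x * f x * G.m x :=
      fun x => mul_nonneg (mul_self_nonneg _) (G.m_pos x).le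
    have h0 := (hasSum_zero_iff_of_nonneg hn).1 (hf ▸ hs.hasSum)
    refine Subtype.ext (funext fun x => ?_)
    have := congrFun h0 x
    change f x = 0
    simpa [(G.m_pos x).ne'] using this

instance : NormedAddCommGroup G.L2 := G.innerCore.toNormedAddCommGroup
instance : InnerProductSpace ℝ G.L2 := InnerProductSpace.ofCore G.innerCore.toCore

/-! ### The form `Q` and the Laplacian `L` -/

/-- The form sums defining `Q(f, f)` converge. -/
def HasFiniteEnergy (f : V → ℝ) : Prop :=
  (Summable fun p : V × V => G.b p.1 p.2 * (f p.1 - f p.2) ^ 2) ∧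
    Summable fun x => G.c x * f x ^ 2

/-- `Q(f,g) = ½ ∑_{x,y} b(x,y) (f(x) - f(y)) (g(x) - g(y)) + ∑_x c(x) f(x) g(x)`, for `f`, `g`
of finite energy. -/
def form (f g : V → ℝ) : ℝ :=
  (1 / 2) * ∑' p : V × V, G.b p.1 p.2 * (f p.1 - f p.2) * (g p.1 - g p.2) +
    ∑' x, G.c x * f x * g x

/-- `D(Q)`: the closure of the finitely supported functions with respect to
`⟨·,·⟩ + Q(·,·)` in `ℓ²(V, m)`. -/
def formDomain : Set G.L2 :=
  {f | G.HasFiniteEnergy f ∧ ∀ ε > 0, ∃ φ : G.L2, (Function.support (φ : V → ℝ)).Finite ∧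
    ‖f - φ‖ ^ 2 + G.form ((f - φ : G.L2) : V → ℝ) ((f - φ : G.L2) : V → ℝ) < ε}

/-- The operator `L` associated with `Q`, given by its graph: `f ∈ D(L)` and `L f = g`
iff `f ∈ D(Q)` and `Q(f, h) = ⟨g, h⟩` for all `h ∈ D(Q)`. -/
def IsLaplacian (f g : G.L2) : Prop :=
  f ∈ G.formDomain ∧ ∀ h ∈ G.formDomain, G.form f h = inner ℝ g h

/-- `T t = e^{-tL}` for all `t ≥ 0`: the strongly continuous semigroup of bounded operators on
`ℓ²(V, m)` whose infinitesimal generator is exactly `-L`, domain included. A strongly continuous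
semigroup is determined by its generator, so these conditions hold for precisely one `T`. -/
structure IsHeatSemigroup (T : ℝ≥0 → G.L2 →L[ℝ] G.L2) : Prop where
  zero : T 0 = ContinuousLinearMap.id ℝ G.L2
  add : ∀ s t, T (s + t) = (T s).comp (T t)
  continuous : ∀ f, Continuous fun t => T t f
  generator : ∀ f g : G.L2,
    Tendsto (fun t : ℝ≥0 => (t : ℝ)⁻¹ • (f - T t f)) (𝓝[>] 0) (𝓝 g) ↔ G.IsLaplacian f g

/-! ### Averaging over spheres -/

theorem graph_connected (x y : V) : G.graph.Reachable x y := by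
  rw [SimpleGraph.reachable_iff_reflTransGen]
  exact G.connected x y

theorem sphere_finite (x₀ : V) (r : ℕ) : (G.sphere x₀ r).Finite := by
  induction r with
  | zero =>
    refine (Set.finite_singleton x₀).subset fun x hx => ?_
    exact (((G.graph_connected x₀ x).dist_eq_zero_iff).1 hx).symm
  | succ r ih =>
    refine (ih.biUnion fun y _ => G.locallyFinite y).subset fun x hx => ?_
    have hd : G.graph.dist x₀ x = r + 1 := hx
    obtain ⟨p, hp⟩ := (G.graph_connected x x₀).exists_walk_length_eq_dist
    rw [SimpleGraph.dist_comm, hd] at hp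
    cases p with
    | nil => simp at hp
    | @cons _ y _ h q =>
      simp only [SimpleGraph.Walk.length_cons] at hp
      have h1 := SimpleGraph.dist_le q
      obtain ⟨q', hq'⟩ := (G.graph_connected x₀ y).exists_walk_length_eq_dist
      have h2 := SimpleGraph.dist_le (q'.concat h.symm)
      rw [SimpleGraph.Walk.length_concat] at h2
      rw [SimpleGraph.dist_comm] at h1
      have h3 : G.graph.dist x₀ y = r := by omega
      exact Set.mem_biUnion (show y ∈ G.sphere x₀ r from h3) h.symm

/-- The averaging operator `Ã` on all functions:
`(Ãf)(x) = m(S_r)⁻¹ ∑_{y ∈ S_r} f(y) m(y)` for `x ∈ S_r`. -/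
def average (x₀ : V) (f : V → ℝ) (x : V) : ℝ :=
  (1 / ∑ᶠ y ∈ G.sphere x₀ (G.dist x₀ x), G.m y) *
    ∑ᶠ y ∈ G.sphere x₀ (G.dist x₀ x), f y * G.m y

/-- On a single sphere, averaging does not increase the `ℓ²` norm. -/
theorem sum_sphere_average_le (x₀ : V) (f : V → ℝ) (r : ℕ) :
    ∑ x ∈ (G.sphere_finite x₀ r).toFinset, G.average x₀ f x ^ 2 * G.m x ≤
      ∑ x ∈ (G.sphere_finite x₀ r).toFinset, f x ^ 2 * G.m x := by
  set S := (G.sphere_finite x₀ r).toFinset with hS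
  have hmem : ∀ y, y ∈ G.sphere x₀ r ↔ y ∈ S := fun y => by simp [hS]
  have hval : ∀ x ∈ S, G.average x₀ f x = (1 / ∑ y ∈ S, G.m y) * ∑ y ∈ S, f y * G.m y := by
    intro x hx
    have hr : G.dist x₀ x = r := (hmem x).2 hx
    rw [average, hr, finsum_mem_eq_finite_toFinset_sum _ (G.sphere_finite x₀ r),
      finsum_mem_eq_finite_toFinset_sum _ (G.sphere_finite x₀ r)]
  rw [Finset.sum_congr rfl fun x hx => by rw [hval x hx], ← Finset.mul_sum]
  rcases S.eq_empty_or_nonempty with h0 | h0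
  · simp [h0]
  have hM : 0 < ∑ y ∈ S, G.m y := Finset.sum_pos (fun y _ => G.m_pos y) h0
  have hcs : (∑ y ∈ S, f y * G.m y) ^ 2 ≤ (∑ y ∈ S, f y ^ 2 * G.m y) * ∑ y ∈ S, G.m y := by
    refine Finset.sum_sq_le_sum_mul_sum_of_sq_le_mul S (fun y _ => ?_) (fun y _ => (G.m_pos y).le)
      (fun y _ => le_of_eq (by ring))
    exact mul_nonneg (sq_nonneg _) (G.m_pos y).le
  calc (1 / (∑ y ∈ S, G.m y) * ∑ y ∈ S, f y * G.m y) ^ 2 * ∑ y ∈ S, G.m y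
      = (∑ y ∈ S, f y * G.m y) ^ 2 / ∑ y ∈ S, G.m y := by field_simp
    _ ≤ _ := by rwa [div_le_iff₀ hM]

/-- Averaging preserves square summability. -/
theorem average_mem (x₀ : V) {f : V → ℝ} (hf : f ∈ G.ellTwo) : G.average x₀ f ∈ G.ellTwo := by
  classical
  have hf' : Summable fun x => f x ^ 2 * G.m x := hf
  have h0 : ∀ (h : V → ℝ) (x : V), 0 ≤ h x ^ 2 * G.m x :=
    fun h x => mul_nonneg (sq_nonneg _) (G.m_pos x).le
  refine summable_of_sum_le (c := ∑' x, f x ^ 2 * G.m x) (h0 _) fun F => ?_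
  set S : ℕ → Finset V := fun r => (G.sphere_finite x₀ r).toFinset with hS
  have hmem : ∀ r y, y ∈ S r ↔ G.dist x₀ y = r := fun r y => by simp [hS, sphere]
  set R := F.image (G.dist x₀) with hR
  have hdisj : (R : Set ℕ).PairwiseDisjoint S := by
    intro i _ j _ hij
    refine Finset.disjoint_left.2 fun y hi hj => hij ?_
    rw [← (hmem i y).1 hi, (hmem j y).1 hj]
  calc ∑ x ∈ F, G.average x₀ f x ^ 2 * G.m x
      ≤ ∑ x ∈ R.biUnion S, G.average x₀ f x ^ 2 * G.m x := by
        refine Finset.sum_le_sum_of_subset_of_nonneg (fun x hx => ?_) fun x _ _ => h0 _ x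
        exact Finset.mem_biUnion.2
          ⟨G.dist x₀ x, Finset.mem_image_of_mem _ hx, (hmem _ x).2 rfl⟩
    _ = ∑ r ∈ R, ∑ x ∈ S r, G.average x₀ f x ^ 2 * G.m x := Finset.sum_biUnion hdisj
    _ ≤ ∑ r ∈ R, ∑ x ∈ S r, f x ^ 2 * G.m x :=
        Finset.sum_le_sum fun r _ => G.sum_sphere_average_le x₀ f r
    _ = ∑ x ∈ R.biUnion S, f x ^ 2 * G.m x := (Finset.sum_biUnion hdisj).symm
    _ ≤ _ := hf'.sum_le_tsum _ fun x _ => h0 _ x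

/-- The restriction `A` of `Ã` to `ℓ²(V, m)`. -/
def averageL2 (x₀ : V) (f : G.L2) : G.L2 := ⟨G.average x₀ f, G.average_mem x₀ f.2⟩

/-- The heat kernel is spherically symmetric: for some vertex `x₀`, the averaging operator `A`
commutes with `e^{-tL}` for all `t ≥ 0`. -/
def HeatKernelIsSphericallySymmetric : Prop :=
  ∃ x₀ : V, ∃ T : ℝ≥0 → G.L2 →L[ℝ] G.L2, G.IsHeatSemigroup T ∧
    ∀ (t : ℝ≥0) (f : G.L2), G.averageL2 x₀ (T t f) = T t (G.averageL2 x₀ f)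

end WeightedGraph
end

/-! Both properties say that averaging `A` over the spheres about `x₀` commutes with `L`. The bridge
is the identity, for a function `g` of the distance `r` to `x₀`, `L g = κ₊ (g(r) - g(r+1)) + κ₋
(g(r) - g(r-1)) + q g(r)`, valid because an edge joins equal or consecutive spheres
(`formalLaplacian_comp_dist`). Hence the formal Laplacian preserves spherical symmetry exactly when
`κ₊`, `κ₋` and `q` are symmetric: one direction is read off the formula, and the other inserts
indicators of spheres.

If symmetry is preserved, then `A`, an orthogonal projection onto symmetric functions, commutes with
`L` on finitely supported functions and does not increase `Q` there. It therefore extends to a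
contraction of the form domain and maps the graph of `L` to itself (`isLaplacian_averageL2`). It
then commutes with the resolvents, with the exponentials of the Yosida approximations, and with
their limit `e^{-tL}`. Conversely, if `A` commutes with the semigroup, differentiation at `t = 0`
shows that it maps the graph of `L` to itself. Indicators of spheres are finitely supported, hence
in `D(L)`, and fixed by `A`, so their Laplacians are symmetric.

The semigroup is itself constructed here by Hille-Yosida. The range condition on `L` comes from
Lax-Milgram on the form domain, which is complete because the form is closable. Local finiteness
makes spheres finite and puts the finitely supported functions in `D(L)`. -/

noncomputable section

/-! ### The Hille-Yosida theorem for monotone operators on a real Hilbert space -/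

section HilleYosida

variable {H : Type*} [NormedAddCommGroup H] [InnerProductSpace ℝ H]

open NormedSpace

/-- A bounded operator whose quadratic form is nonpositive. -/
def IsDissipative (A : H →L[ℝ] H) : Prop := ∀ f, inner ℝ (A f) f ≤ 0

theorem isDissipative_zero : IsDissipative (0 : H →L[ℝ] H) := fun f => by simp

theorem hasDerivAt_exp_smul_apply [CompleteSpace H] (A : H →L[ℝ] H) (f : H) (s : ℝ) :
    HasDerivAt (fun u : ℝ => exp (u • A) f) (A (exp (s • A) f)) s := by
  have h := (hasDerivAt_exp_smul_const' A s).clm_apply (hasDerivAt_const s f)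
  simpa using h

theorem exp_smul_apply_comm (A : H →L[ℝ] H) (f : H) (s : ℝ) :
    A (exp (s • A) f) = exp (s • A) (A f) :=
  DFunLike.congr_fun (((Commute.refl A).smul_right s).exp_right).eq f

theorem exp_add_smul_apply [CompleteSpace H] (A : H →L[ℝ] H) (s t : ℝ) (f : H) :
    exp ((s + t) • A) f = exp (s • A) (exp (t • A) f) := by
  let _ : NormedAlgebra ℚ (H →L[ℝ] H) := NormedAlgebra.restrictScalars ℚ ℝ _
  rw [add_smul, exp_add_of_commute (((Commute.refl A).smul_left s).smul_right t)]
  rfl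

theorem IsDissipative.norm_exp_smul_apply_le [CompleteSpace H] {A : H →L[ℝ] H}
    (hA : IsDissipative A) {t : ℝ}
    (ht : 0 ≤ t) (f : H) : ‖exp (t • A) f‖ ≤ ‖f‖ := by
  have hd : ∀ s : ℝ, HasDerivAt (fun u : ℝ => ‖exp (u • A) f‖ ^ 2)
      (2 * inner ℝ (exp (s • A) f) (A (exp (s • A) f))) s :=
    fun s => (hasDerivAt_exp_smul_apply A f s).norm_sq
  have hanti : Antitone fun u : ℝ => ‖exp (u • A) f‖ ^ 2 := by
    refine antitone_of_deriv_nonpos (fun s => (hd s).differentiableAt) fun s => ?_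
    rw [(hd s).deriv, real_inner_comm]
    linarith [hA (exp (s • A) f)]
  have h := hanti ht
  simp only [zero_smul, exp_zero, one_apply_eq_self] at h
  exact (sq_le_sq₀ (norm_nonneg _) (norm_nonneg _)).1 h

/-- The path `u ↦ exp(uA) exp((t-u)B) f` runs from `exp(tB) f` to `exp(tA) f`. Since `A` and `B`
commute, its derivative is a product of contractions applied to `Af - Bf`. -/
theorem norm_exp_smul_sub_exp_smul_le [CompleteSpace H] {A B : H →L[ℝ] H} (hA : IsDissipative A)
    (hB : IsDissipative B) (hAB : Commute A B) {t : ℝ} (ht : 0 ≤ t) (f : H) :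
    ‖exp (t • A) f - exp (t • B) f‖ ≤ t * ‖A f - B f‖ := by
  have hd : ∀ s : ℝ, HasDerivAt (fun u : ℝ => exp (u • A) (exp ((t - u) • B) f))
      (exp (s • A) (exp ((t - s) • B) (A f - B f))) s := by
    intro s
    have h1 : HasDerivAt (fun u : ℝ => exp ((t - u) • B) f)
        (-(B (exp ((t - s) • B) f))) s := by
      have := (hasDerivAt_exp_smul_apply B f (t - s)).scomp s ((hasDerivAt_id s).const_sub t)
      simpa [Function.comp_def] using this
    have h2 := (hasDerivAt_exp_smul_const A s).clm_apply h1
    refine h2.congr_deriv ?_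
    have h3 : A (exp ((t - s) • B) f) = exp ((t - s) • B) (A f) :=
      DFunLike.congr_fun ((hAB.smul_right (t - s)).exp_right).eq f
    rw [exp_smul_apply_comm, mul_apply_eq_comp, h3, ← map_add, ← sub_eq_add_neg,
      ← map_sub]
  have h := norm_image_sub_le_of_norm_deriv_le_segment' (a := 0) (b := t) (C := ‖A f - B f‖)
    (fun s _ => (hd s).hasDerivWithinAt) (fun s hs => ?_) t ⟨ht, le_rfl⟩
  · simpa [mul_comm] using h
  · exact (hA.norm_exp_smul_apply_le hs.1 _).trans
      (hB.norm_exp_smul_apply_le (sub_nonneg.2 hs.2.le) _)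

theorem IsDissipative.norm_exp_smul_sub_self_le [CompleteSpace H] {A : H →L[ℝ] H}
    (hA : IsDissipative A) {t : ℝ}
    (ht : 0 ≤ t) (f : H) : ‖exp (t • A) f - f‖ ≤ t * ‖A f‖ := by
  simpa using norm_exp_smul_sub_exp_smul_le hA isDissipative_zero (Commute.zero_right A) ht f

/-- A first-order Taylor estimate that avoids `A (A f)`: the free vector `g` stands in for `A f`.
For Yosida approximations `A g` is bounded uniformly when `g` is in the domain of `L`, whereas `A (A
f)` need not be. -/
theorem IsDissipative.norm_exp_smul_sub_sub_le [CompleteSpace H] {A : H →L[ℝ] H}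
    (hA : IsDissipative A) {t : ℝ}
    (ht : 0 ≤ t) (f g : H) :
    ‖exp (t • A) f - f - t • A f‖ ≤ t * (2 * ‖A f - g‖ + t * ‖A g‖) := by
  have hd : ∀ s : ℝ, HasDerivAt (fun u : ℝ => exp (u • A) f - u • A f)
      (exp (s • A) (A f) - A f) s := by
    intro s
    have h := (hasDerivAt_exp_smul_apply A f s).sub ((hasDerivAt_id s).smul_const (A f))
    rw [exp_smul_apply_comm, one_smul] at h
    exact h
  have h := norm_image_sub_le_of_norm_deriv_le_segment' (a := 0) (b := t)
    (C := 2 * ‖A f - g‖ + t * ‖A g‖)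
    (fun s _ => (hd s).hasDerivWithinAt) (fun s hs => ?_) t ⟨ht, le_rfl⟩
  · simp only [zero_smul, exp_zero, one_apply_eq_self, sub_zero] at h
    rw [sub_right_comm, mul_comm t]
    exact h
  · have e : exp (s • A) (A f) - A f
        = exp (s • A) (A f - g) + (exp (s • A) g - g) - (A f - g) := by
      rw [map_sub]; abel
    rw [e]
    have h1 := hA.norm_exp_smul_apply_le hs.1 (A f - g)
    have h2 := hA.norm_exp_smul_sub_self_le hs.1 g
    have h3 : s * ‖A g‖ ≤ t * ‖A g‖ := mul_le_mul_of_nonneg_right hs.2.le (norm_nonneg _)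
    have h4 := norm_sub_le (exp (s • A) (A f - g) + (exp (s • A) g - g)) (A f - g)
    have h5 := norm_add_le (exp (s • A) (A f - g)) (exp (s • A) g - g)
    linarith

/-- The graph `L` of a densely defined monotone linear operator for which `1 + L / (n + 1)` is
onto for all `n`. -/
structure IsMaximalMonotone (L : Submodule ℝ (H × H)) : Prop where
  inner_nonneg : ∀ f g, (f, g) ∈ L → 0 ≤ inner ℝ g f
  exists_resolvent : ∀ (n : ℕ) (g : H), ∃ f, (f, ((n : ℝ) + 1) • (g - f)) ∈ L
  dense : Dense {f | ∃ g, (f, g) ∈ L}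

/-! ### Resolvents and Yosida approximations -/

namespace IsMaximalMonotone

variable {L : Submodule ℝ (H × H)}

/-- The membership encodes `f + a⁻¹ L f = g`. Pairing `a (g - f)` with `f` and using monotonicity
gives `‖f‖² ≤ ⟨g, f⟩`. -/
theorem norm_le_of_resolvent (hL : IsMaximalMonotone L) {a : ℝ} (ha : 0 < a) {f g : H}
    (h : (f, a • (g - f)) ∈ L) :
    ‖f‖ ≤ ‖g‖ := by
  have h1 := hL.inner_nonneg _ _ h
  rw [real_inner_smul_left, inner_sub_left, real_inner_self_eq_norm_sq] at h1
  have h2 := nonneg_of_mul_nonneg_right h1 ha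
  have h3 := real_inner_le_norm g f
  by_contra! hlt
  nlinarith [norm_nonneg g, norm_nonneg f]

theorem resolvent_unique (hL : IsMaximalMonotone L) {a : ℝ} (ha : 0 < a) {f f' g : H}
    (h : (f, a • (g - f)) ∈ L) (h' : (f', a • (g - f')) ∈ L) : f = f' := by
  have h1 : (f - f', a • ((0 : H) - (f - f'))) ∈ L := by
    have := L.sub_mem h h'
    rw [Prod.mk_sub_mk, ← smul_sub] at this
    convert this using 3
    abel
  have h2 := hL.norm_le_of_resolvent ha h1
  rw [norm_zero] at h2
  exact sub_eq_zero.1 (norm_le_zero_iff.1 h2)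

/-- The resolvent `(1 + L / (n + 1))⁻¹`. -/
def resolvent (hL : IsMaximalMonotone L) (n : ℕ) : H →L[ℝ] H :=
  LinearMap.mkContinuous
    { toFun := fun g => (hL.exists_resolvent n g).choose
      map_add' := fun g g' => by
        refine hL.resolvent_unique n.cast_add_one_pos
          (hL.exists_resolvent n (g + g')).choose_spec ?_
        have h := L.add_mem (hL.exists_resolvent n g).choose_spec
          (hL.exists_resolvent n g').choose_spec
        rw [Prod.mk_add_mk, ← smul_add] at h
        convert h using 3
        abel
      map_smul' := fun a g => by
        refine hL.resolvent_unique n.cast_add_one_pos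
          (hL.exists_resolvent n (a • g)).choose_spec ?_
        have h := L.smul_mem a (hL.exists_resolvent n g).choose_spec
        rw [Prod.smul_mk, smul_comm, smul_sub] at h
        exact h }
    1 fun g => by
      rw [one_mul]
      exact hL.norm_le_of_resolvent n.cast_add_one_pos (hL.exists_resolvent n g).choose_spec

theorem resolvent_mem (hL : IsMaximalMonotone L) (n : ℕ) (g : H) :
    (hL.resolvent n g, ((n : ℝ) + 1) • (g - hL.resolvent n g)) ∈ L :=
  (hL.exists_resolvent n g).choose_spec

theorem norm_resolvent_le (hL : IsMaximalMonotone L) (n : ℕ) (g : H) :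
    ‖hL.resolvent n g‖ ≤ ‖g‖ :=
  hL.norm_le_of_resolvent n.cast_add_one_pos (hL.resolvent_mem n g)

theorem eq_resolvent (hL : IsMaximalMonotone L) {n : ℕ} {f g : H}
    (h : (f, ((n : ℝ) + 1) • (g - f)) ∈ L) : f = hL.resolvent n g :=
  hL.resolvent_unique n.cast_add_one_pos h (hL.resolvent_mem n g)

/-- The (negative of the) Yosida approximation of `L`. -/
def yosida (hL : IsMaximalMonotone L) (n : ℕ) : H →L[ℝ] H :=
  ((n : ℝ) + 1) • (hL.resolvent n - 1)

theorem yosida_apply (hL : IsMaximalMonotone L) (n : ℕ) (f : H) :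
    hL.yosida n f = ((n : ℝ) + 1) • (hL.resolvent n f - f) := rfl

theorem isDissipative_yosida (hL : IsMaximalMonotone L) (n : ℕ) :
    IsDissipative (hL.yosida n) := fun f => by
  rw [yosida_apply, real_inner_smul_left, inner_sub_left, real_inner_self_eq_norm_sq]
  refine mul_nonpos_of_nonneg_of_nonpos n.cast_add_one_pos.le ?_
  have h1 := real_inner_le_norm (hL.resolvent n f) f
  have h2 := hL.norm_resolvent_le n f
  nlinarith [norm_nonneg f]

/-- Since `f` is the resolvent of `f + (n+1)⁻¹ g`, the large factor `n + 1` cancels. On the domain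
the approximations are thus bounded uniformly in `n`, and they converge to `-L`. -/
theorem yosida_of_mem (hL : IsMaximalMonotone L) (n : ℕ) {f g : H} (h : (f, g) ∈ L) :
    hL.yosida n f = -hL.resolvent n g := by
  have hn : ((n : ℝ) + 1) ≠ 0 := n.cast_add_one_pos.ne'
  have h1 : f = hL.resolvent n (f + ((n : ℝ) + 1)⁻¹ • g) := by
    refine hL.eq_resolvent ?_
    rwa [add_sub_cancel_left, smul_inv_smul₀ hn]
  rw [map_add, map_smul] at h1
  have h2 : hL.resolvent n f - f = -(((n : ℝ) + 1)⁻¹ • hL.resolvent n g) := by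
    nth_rewrite 2 [h1]
    abel
  rw [yosida_apply, h2, smul_neg, smul_inv_smul₀ hn]

theorem norm_yosida_le (hL : IsMaximalMonotone L) (n : ℕ) {f g : H} (h : (f, g) ∈ L) :
    ‖hL.yosida n f‖ ≤ ‖g‖ := by
  rw [hL.yosida_of_mem n h, norm_neg]
  exact hL.norm_resolvent_le n g

/-- A bounded operator commutes with `L` if it maps the graph of `L` to itself. -/
theorem commute_resolvent (hL : IsMaximalMonotone L) {C : H →L[ℝ] H}
    (hC : ∀ f g, (f, g) ∈ L → (C f, C g) ∈ L) (n : ℕ) : Commute C (hL.resolvent n) := by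
  ext g
  refine hL.eq_resolvent ?_
  have h := hC _ _ (hL.resolvent_mem n g)
  rwa [map_smul, map_sub] at h

theorem commute_yosida (hL : IsMaximalMonotone L) {C : H →L[ℝ] H}
    (hC : ∀ f g, (f, g) ∈ L → (C f, C g) ∈ L) (n : ℕ) : Commute C (hL.yosida n) :=
  ((hL.commute_resolvent hC n).sub_right (Commute.one_right C)).smul_right _

/-- Makes each resolvent an admissible `C` in `commute_yosida`, so that the Yosida approximations
commute with one another. -/
theorem resolvent_map_mem (hL : IsMaximalMonotone L) (n : ℕ) {f g : H} (h : (f, g) ∈ L) :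
    (hL.resolvent n f, hL.resolvent n g) ∈ L := by
  have h1 := hL.resolvent_mem n f
  rwa [← neg_sub, smul_neg, ← yosida_apply, hL.yosida_of_mem n h, neg_neg] at h1

theorem commute_yosida_yosida (hL : IsMaximalMonotone L) (n k : ℕ) :
    Commute (hL.yosida n) (hL.yosida k) := by
  refine (Commute.sub_left ?_ (Commute.one_left _)).smul_left _
  exact hL.commute_yosida (fun f g h => hL.resolvent_map_mem n h) k

/-- On the domain the error is the Yosida approximation divided by `n + 1`, hence at most `‖f'‖ /
(n+1)`. Density and contractivity do the rest. -/
theorem tendsto_resolvent (hL : IsMaximalMonotone L) (g : H) :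
    Tendsto (fun n => hL.resolvent n g) atTop (𝓝 g) := by
  rw [Metric.tendsto_atTop]
  intro ε hε
  obtain ⟨f, ⟨f', hf⟩, hfg⟩ := hL.dense.exists_dist_lt g (show 0 < ε / 3 by positivity)
  obtain ⟨N, hN⟩ := exists_nat_gt (3 * ‖f'‖ / ε)
  refine ⟨N, fun n hn => ?_⟩
  have hn1 : (0 : ℝ) < n + 1 := n.cast_add_one_pos
  have h1 : ‖hL.resolvent n f - f‖ < ε / 3 := by
    have h2 := hL.norm_yosida_le n hf
    rw [yosida_apply, norm_smul, Real.norm_of_nonneg hn1.le] at h2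
    have h3 : (N : ℝ) ≤ n := by exact_mod_cast hn
    rw [div_lt_iff₀ hε] at hN
    by_contra! h4
    nlinarith
  have h2 := hL.norm_resolvent_le n (g - f)
  rw [map_sub] at h2
  rw [dist_eq_norm] at hfg ⊢
  have e : hL.resolvent n g - g
      = (hL.resolvent n g - hL.resolvent n f) + (hL.resolvent n f - f) - (g - f) := by abel
  rw [e]
  have h4 := norm_sub_le ((hL.resolvent n g - hL.resolvent n f) + (hL.resolvent n f - f)) (g - f)
  have h5 := norm_add_le (hL.resolvent n g - hL.resolvent n f) (hL.resolvent n f - f)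
  linarith

/-! ### The semigroup as a limit of exponentials -/

theorem cauchySeq_exp_yosida [CompleteSpace H] (hL : IsMaximalMonotone L) {t : ℝ} (ht : 0 ≤ t)
    (f : H) : CauchySeq fun n => exp (t • hL.yosida n) f := by
  rw [Metric.cauchySeq_iff]
  intro ε hε
  obtain ⟨φ, ⟨g, hφ⟩, hfφ⟩ := hL.dense.exists_dist_lt f (show 0 < ε / 3 by positivity)
  -- On `φ` the exponentials differ by at most `t` times the difference of the resolvents of `g`.
  -- Dividing by `t + 1` rather than `t` also covers `t = 0`.
  obtain ⟨N, hN⟩ := Metric.cauchySeq_iff.1 (hL.tendsto_resolvent g).cauchySeq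
    (ε / 3 / (t + 1)) (by positivity)
  refine ⟨N, fun n hn k hk => ?_⟩
  have h1 := norm_exp_smul_sub_exp_smul_le (hL.isDissipative_yosida n)
    (hL.isDissipative_yosida k) (hL.commute_yosida_yosida n k) ht φ
  have h2 := hN n hn k hk
  rw [dist_eq_norm, lt_div_iff₀ (by positivity)] at h2
  rw [hL.yosida_of_mem n hφ, hL.yosida_of_mem k hφ, ← neg_sub', norm_neg] at h1
  have h3 := (hL.isDissipative_yosida n).norm_exp_smul_apply_le ht (f - φ)
  have h4 := (hL.isDissipative_yosida k).norm_exp_smul_apply_le ht (f - φ)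
  rw [dist_eq_norm] at hfφ ⊢
  have e : exp (t • hL.yosida n) f - exp (t • hL.yosida k) f = exp (t • hL.yosida n) (f - φ) +
      (exp (t • hL.yosida n) φ - exp (t • hL.yosida k) φ) - exp (t • hL.yosida k) (f - φ) := by
    simp only [map_sub]
    abel
  rw [e]
  have h5 := norm_sub_le (exp (t • hL.yosida n) (f - φ) +
      (exp (t • hL.yosida n) φ - exp (t • hL.yosida k) φ)) (exp (t • hL.yosida k) (f - φ))
  have h6 := norm_add_le (exp (t • hL.yosida n) (f - φ))
      (exp (t • hL.yosida n) φ - exp (t • hL.yosida k) φ)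
  nlinarith [norm_nonneg (hL.resolvent n g - hL.resolvent k g)]

/-- The contraction semigroup generated by `-L`. -/
def semigroup [CompleteSpace H] (hL : IsMaximalMonotone L) (t : ℝ≥0) : H →L[ℝ] H :=
  continuousLinearMapOfTendsto (fun n => exp ((t : ℝ) • hL.yosida n)) <| tendsto_pi_nhds.2
    fun f => (cauchySeq_tendsto_of_complete (hL.cauchySeq_exp_yosida t.2 f)).choose_spec

variable [CompleteSpace H]

theorem tendsto_semigroup (hL : IsMaximalMonotone L) (t : ℝ≥0) (f : H) :
    Tendsto (fun n => exp ((t : ℝ) • hL.yosida n) f) atTop (𝓝 (hL.semigroup t f)) :=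
  (cauchySeq_tendsto_of_complete (hL.cauchySeq_exp_yosida t.2 f)).choose_spec

theorem norm_semigroup_le (hL : IsMaximalMonotone L) (t : ℝ≥0) (f : H) :
    ‖hL.semigroup t f‖ ≤ ‖f‖ :=
  le_of_tendsto (hL.tendsto_semigroup t f).norm <| Eventually.of_forall fun n =>
    (hL.isDissipative_yosida n).norm_exp_smul_apply_le t.2 f

theorem semigroup_zero (hL : IsMaximalMonotone L) :
    hL.semigroup 0 = ContinuousLinearMap.id ℝ H := by
  ext f
  refine tendsto_nhds_unique (hL.tendsto_semigroup 0 f) ?_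
  simp

theorem semigroup_add (hL : IsMaximalMonotone L) (s t : ℝ≥0) :
    hL.semigroup (s + t) = (hL.semigroup s).comp (hL.semigroup t) := by
  ext f
  refine tendsto_nhds_unique (hL.tendsto_semigroup (s + t) f) ?_
  -- Contractivity of `exp(s A_n)` allows replacing the limit `T_t f` by `exp(t A_n) f` inside it.
  refine (hL.tendsto_semigroup s (hL.semigroup t f)).congr_dist ?_
  refine squeeze_zero (fun _ => dist_nonneg) (fun n => ?_)
    (tendsto_iff_norm_sub_tendsto_zero.1 (hL.tendsto_semigroup t f))
  rw [dist_comm, dist_eq_norm, NNReal.coe_add, exp_add_smul_apply, ← map_sub]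
  exact (hL.isDissipative_yosida n).norm_exp_smul_apply_le s.2 _

/-- A bounded operator commuting with `L` commutes with the semigroup. -/
theorem semigroup_comm (hL : IsMaximalMonotone L) {C : H →L[ℝ] H}
    (hC : ∀ f g, (f, g) ∈ L → (C f, C g) ∈ L) (t : ℝ≥0) (f : H) :
    C (hL.semigroup t f) = hL.semigroup t (C f) := by
  refine tendsto_nhds_unique ((C.continuous.tendsto _).comp (hL.tendsto_semigroup t f)) ?_
  refine (hL.tendsto_semigroup t (C f)).congr fun n => ?_
  exact (DFunLike.congr_fun (((hL.commute_yosida hC n).smul_right (t : ℝ)).exp_right).eq f).symm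

theorem norm_semigroup_sub_self_le (hL : IsMaximalMonotone L) (t : ℝ≥0) {f g : H}
    (h : (f, g) ∈ L) : ‖hL.semigroup t f - f‖ ≤ t * ‖g‖ := by
  refine le_of_tendsto ((hL.tendsto_semigroup t f).sub_const f).norm <|
    Eventually.of_forall fun n => ?_
  refine ((hL.isDissipative_yosida n).norm_exp_smul_sub_self_le t.2 f).trans ?_
  exact mul_le_mul_of_nonneg_left (hL.norm_yosida_le n h) t.2

theorem tendsto_semigroup_zero (hL : IsMaximalMonotone L) (f : H) :
    Tendsto (fun t => hL.semigroup t f) (𝓝 0) (𝓝 f) := by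
  rw [Metric.tendsto_nhds]
  intro ε hε
  obtain ⟨φ, ⟨g, hφ⟩, hfφ⟩ := hL.dense.exists_dist_lt f (show 0 < ε / 3 by positivity)
  have hlim : Tendsto (fun t : ℝ≥0 => (t : ℝ) * ‖g‖) (𝓝 0) (𝓝 0) := by
    have h : Continuous fun t : ℝ≥0 => (t : ℝ) * ‖g‖ := by fun_prop
    simpa using h.tendsto 0
  filter_upwards [hlim.eventually (gt_mem_nhds (show 0 < ε / 3 by positivity))] with t ht
  have h1 := hL.norm_semigroup_sub_self_le t hφ
  have h2 := hL.norm_semigroup_le t (f - φ)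
  rw [dist_eq_norm] at hfφ ⊢
  have e : hL.semigroup t f - f
      = hL.semigroup t (f - φ) + (hL.semigroup t φ - φ) - (f - φ) := by
    rw [map_sub]
    abel
  rw [e]
  have h5 := norm_sub_le (hL.semigroup t (f - φ) + (hL.semigroup t φ - φ)) (f - φ)
  have h6 := norm_add_le (hL.semigroup t (f - φ)) (hL.semigroup t φ - φ)
  linarith

theorem norm_semigroup_sub_le (hL : IsMaximalMonotone L) {s t : ℝ≥0} (hst : s ≤ t) (f : H) :
    ‖hL.semigroup t f - hL.semigroup s f‖ ≤ ‖hL.semigroup (t - s) f - f‖ := by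
  have e : hL.semigroup t f = hL.semigroup s (hL.semigroup (t - s) f) := by
    rw [← ContinuousLinearMap.comp_apply, ← semigroup_add, add_tsub_cancel_of_le hst]
  rw [e, ← map_sub]
  exact hL.norm_semigroup_le s _

theorem continuous_semigroup (hL : IsMaximalMonotone L) (f : H) :
    Continuous fun t => hL.semigroup t f := by
  rw [continuous_iff_continuousAt]
  intro s
  -- With truncated subtraction, `(t - s) + (s - t)` is `|t - s|`.
  have hlim : Tendsto (fun t : ℝ≥0 => (t - s) + (s - t)) (𝓝 s) (𝓝 0) := by
    have h : Continuous fun t : ℝ≥0 => (t - s) + (s - t) := by fun_prop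
    simpa using h.tendsto s
  rw [ContinuousAt, tendsto_iff_norm_sub_tendsto_zero]
  refine squeeze_zero (fun _ => norm_nonneg _) (fun t => ?_)
    (tendsto_iff_norm_sub_tendsto_zero.1 ((hL.tendsto_semigroup_zero f).comp hlim))
  rcases le_total s t with h | h
  · simpa [tsub_eq_zero_of_le h] using hL.norm_semigroup_sub_le h f
  · rw [norm_sub_rev]
    simpa [tsub_eq_zero_of_le h] using hL.norm_semigroup_sub_le h f

/-- The Taylor estimate for the Yosida approximations, with `-φ` in place of the free vector, passed
to the limit. The error is `o(t)` because `φ` can be taken in the domain and arbitrarily close to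
`g`. -/
theorem norm_sub_semigroup_sub_le (hL : IsMaximalMonotone L) (t : ℝ≥0) {f g φ ψ : H}
    (h : (f, g) ∈ L) (hφ : (φ, ψ) ∈ L) :
    ‖f - hL.semigroup t f - (t : ℝ) • g‖ ≤ t * (2 * ‖g - φ‖ + t * ‖ψ‖) := by
  have h1 : Tendsto (fun n => ‖exp ((t : ℝ) • hL.yosida n) f - f - (t : ℝ) • hL.yosida n f‖)
      atTop (𝓝 ‖hL.semigroup t f - f - (t : ℝ) • (-g)‖) := by
    refine (((hL.tendsto_semigroup t f).sub_const f).sub (Tendsto.const_smul ?_ _)).norm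
    simp_rw [hL.yosida_of_mem _ h]
    exact (hL.tendsto_resolvent g).neg
  have h2 : Tendsto (fun n => (t : ℝ) * (2 * ‖hL.yosida n f - (-φ)‖ + t * ‖ψ‖)) atTop
      (𝓝 ((t : ℝ) * (2 * ‖-g - (-φ)‖ + t * ‖ψ‖))) := by
    refine ((Tendsto.const_mul 2 (Tendsto.norm (Tendsto.sub_const ?_ _))).add_const _).const_mul _
    simp_rw [hL.yosida_of_mem _ h]
    exact (hL.tendsto_resolvent g).neg
  have h3 := le_of_tendsto_of_tendsto' h1 h2 fun n => by
    refine ((hL.isDissipative_yosida n).norm_exp_smul_sub_sub_le t.2 f (-φ)).trans ?_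
    have := hL.norm_yosida_le n hφ
    rw [map_neg, norm_neg]
    exact mul_le_mul_of_nonneg_left (add_le_add_right (mul_le_mul_of_nonneg_left this t.2) _) t.2
  rw [← norm_neg]
  rw [show -g - -φ = -(g - φ) by abel, norm_neg] at h3
  rwa [show -(f - hL.semigroup t f - (t : ℝ) • g) = hL.semigroup t f - f - (t : ℝ) • (-g) by
    rw [smul_neg]; abel]

theorem tendsto_generator (hL : IsMaximalMonotone L) {f g : H} (h : (f, g) ∈ L) :
    Tendsto (fun t : ℝ≥0 => (t : ℝ)⁻¹ • (f - hL.semigroup t f)) (𝓝[>] 0) (𝓝 g) := by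
  rw [Metric.tendsto_nhds]
  intro ε hε
  obtain ⟨φ, ⟨ψ, hφ⟩, hgφ⟩ := hL.dense.exists_dist_lt g (show 0 < ε / 4 by positivity)
  have hlim : Tendsto (fun t : ℝ≥0 => (t : ℝ) * ‖ψ‖) (𝓝 0) (𝓝 0) := by
    have h : Continuous fun t : ℝ≥0 => (t : ℝ) * ‖ψ‖ := by fun_prop
    simpa using h.tendsto 0
  filter_upwards [nhdsWithin_le_nhds
      (hlim.eventually (gt_mem_nhds (show 0 < ε / 2 by positivity))),
    self_mem_nhdsWithin] with t ht ht0
  have ht1 : (0 : ℝ) < t := ht0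
  have h1 := hL.norm_sub_semigroup_sub_le t h hφ
  rw [dist_eq_norm] at hgφ ⊢
  have e : (t : ℝ)⁻¹ • (f - hL.semigroup t f) - g
      = (t : ℝ)⁻¹ • (f - hL.semigroup t f - (t : ℝ) • g) := by
    rw [smul_sub _ (f - hL.semigroup t f), inv_smul_smul₀ ht1.ne']
  rw [e, norm_smul, norm_inv, Real.norm_of_nonneg ht1.le, inv_mul_lt_iff₀ ht1]
  refine h1.trans_lt (mul_lt_mul_of_pos_left ?_ ht1)
  linarith

/-- The infinitesimal generator of the semigroup is exactly `-L`. -/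
theorem tendsto_generator_iff (hL : IsMaximalMonotone L) (f g : H) :
    Tendsto (fun t : ℝ≥0 => (t : ℝ)⁻¹ • (f - hL.semigroup t f)) (𝓝[>] 0) (𝓝 g) ↔
      (f, g) ∈ L := by
  refine ⟨fun h => ?_, hL.tendsto_generator⟩
  -- Maximality: `f'` solves `f' + L f' = f + g`. Contractivity makes the generator monotone, and
  -- pairing the difference of the two generator values with `f - f'` yields `-‖f - f'‖² ≥ 0`.
  have h0 := hL.resolvent_mem 0 (f + g)
  set f' := hL.resolvent 0 (f + g) with hf'
  simp only [Nat.cast_zero, zero_add, one_smul] at h0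
  have h1 := (h.sub (hL.tendsto_generator h0)).inner (𝕜 := ℝ)
    (tendsto_const_nhds (x := f - f'))
  have h2 : 0 ≤ inner ℝ (g - (f + g - f')) (f - f') := by
    refine ge_of_tendsto h1 (Eventually.of_forall fun t => ?_)
    rw [← smul_sub, real_inner_smul_left]
    refine mul_nonneg (inv_nonneg.2 t.2) ?_
    have e : f - hL.semigroup t f - (f' - hL.semigroup t f')
        = (f - f') - hL.semigroup t (f - f') := by
      rw [map_sub]
      abel
    rw [e, inner_sub_left, real_inner_self_eq_norm_sq]
    have h3 := real_inner_le_norm (hL.semigroup t (f - f')) (f - f')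
    have h4 := hL.norm_semigroup_le t (f - f')
    nlinarith [norm_nonneg (f - f')]
  rw [show g - (f + g - f') = -(f - f') by abel, inner_neg_left,
    real_inner_self_eq_norm_sq] at h2
  have h3 : f = f' := by
    have : ‖f - f'‖ = 0 := by nlinarith [norm_nonneg (f - f')]
    exact sub_eq_zero.1 (norm_eq_zero.1 this)
  rw [← h3, add_sub_cancel_left] at h0
  exact h0

end IsMaximalMonotone
end HilleYosida
end

/-! ### Lax-Milgram and the Hilbert space setting -/

noncomputable section

/-- Solvability of a shifted variational problem, by the Lax-Milgram theorem. -/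
theorem exists_inner_add_inner_eq {E H : Type*} [NormedAddCommGroup E] [InnerProductSpace ℝ E]
    [CompleteSpace E] [NormedAddCommGroup H] [InnerProductSpace ℝ H] [CompleteSpace H]
    (F : E →L[ℝ] H) {a : ℝ} (ha : 0 ≤ a) (g : H) :
    ∃ u : E, ∀ v : E, inner ℝ u v + a * inner ℝ (F u) (F v) = inner ℝ g (F v) := by
  let B : E →L[ℝ] E →L[ℝ] ℝ := innerSL ℝ + a • (innerSL ℝ).bilinearComp F F
  have hB : ∀ u v, B u v = inner ℝ u v + a * inner ℝ (F u) (F v) := fun u v => rfl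
  have hco : IsCoercive B := by
    refine ⟨1, one_pos, fun u => ?_⟩
    rw [hB, real_inner_self_eq_norm_sq, real_inner_self_eq_norm_sq]
    nlinarith [mul_nonneg ha (sq_nonneg ‖F u‖)]
  refine ⟨hco.continuousLinearEquivOfBilin.symm (F.adjoint g), fun v => ?_⟩
  rw [← hB, ← hco.continuousLinearEquivOfBilin_apply, ContinuousLinearEquiv.apply_symm_apply,
    ContinuousLinearMap.adjoint_inner_left]

namespace WeightedGraph

variable {V : Type*} (G : WeightedGraph V)

/-! ### The Hilbert space `ℓ²(V, m)`: completeness and finitely supported functions -/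

namespace L2

variable {G}

@[ext] theorem ext {f g : G.L2} (h : ∀ x, f x = g x) : f = g := Subtype.ext (funext h)

theorem inner_eq (f g : G.L2) : inner ℝ f g = ∑' x, f x * g x * G.m x := rfl

theorem norm_sq_eq (f : G.L2) : ‖f‖ ^ 2 = ∑' x, f x ^ 2 * G.m x := by
  rw [← real_inner_self_eq_norm_sq, inner_eq]
  exact tsum_congr fun x => by ring

theorem summable_sq (f : G.L2) : Summable fun x => f x ^ 2 * G.m x := f.2

theorem sq_apply_mul_le (f : G.L2) (x : V) : f x ^ 2 * G.m x ≤ ‖f‖ ^ 2 := by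
  rw [norm_sq_eq]
  exact (summable_sq f).le_tsum x fun y _ => mul_nonneg (sq_nonneg _) (G.m_pos y).le

/-- Evaluation at a vertex. -/
def eval (x : V) : G.L2 →L[ℝ] ℝ :=
  LinearMap.mkContinuous
    { toFun := fun f => f x
      map_add' := fun _ _ => rfl
      map_smul' := fun _ _ => rfl } (√(G.m x))⁻¹ fun f => by
    have hm := Real.sqrt_pos.2 (G.m_pos x)
    change |f x| ≤ _
    rw [inv_mul_eq_div, le_div_iff₀ hm]
    refine abs_le_of_sq_le_sq' ?_ (norm_nonneg f) |>.2
    rw [mul_pow, Real.sq_sqrt (G.m_pos x).le, sq_abs]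
    exact sq_apply_mul_le f x

variable (G) in
/-- Multiplication by `√m` identifies `ℓ²(V, m)` with the unweighted `ℓ²(V)`. -/
def equivLp : G.L2 ≃ₗᵢ[ℝ] lp (fun _ : V => ℝ) 2 where
  toFun f := ⟨fun x => √(G.m x) * f x, by
    refine (memℓp_gen_iff (by norm_num)).2 ?_
    refine (summable_sq f).congr fun x => ?_
    rw [ENNReal.toReal_ofNat, Real.rpow_two, Real.norm_eq_abs, sq_abs, mul_pow,
      Real.sq_sqrt (G.m_pos x).le, mul_comm]⟩
  invFun u := ⟨fun x => (√(G.m x))⁻¹ * u x, by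
    have h := (memℓp_gen_iff (by norm_num)).1 u.2
    refine h.congr fun x => ?_
    have hm := G.m_pos x
    rw [ENNReal.toReal_ofNat, Real.rpow_two, Real.norm_eq_abs, sq_abs, mul_pow, inv_pow,
      Real.sq_sqrt hm.le, mul_right_comm, inv_mul_cancel₀ hm.ne', one_mul]⟩
  map_add' f g := by
    ext x
    exact mul_add _ _ _
  map_smul' a f := by
    ext x
    exact mul_left_comm _ _ _
  left_inv f := by
    ext x
    exact inv_mul_cancel_left₀ (Real.sqrt_pos.2 (G.m_pos x)).ne' _
  right_inv u := by
    ext x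
    exact mul_inv_cancel_left₀ (Real.sqrt_pos.2 (G.m_pos x)).ne' _
  norm_map' f := by
    refine (sq_eq_sq₀ (norm_nonneg _) (norm_nonneg _)).1 ?_
    rw [← real_inner_self_eq_norm_sq, lp.inner_eq_tsum, norm_sq_eq]
    refine tsum_congr fun x => ?_
    change (√(G.m x) * f x) * (√(G.m x) * f x) = _
    rw [mul_mul_mul_comm, Real.mul_self_sqrt (G.m_pos x).le]
    ring

instance : CompleteSpace G.L2 :=
  (equivLp G).toIsometryEquiv.completeSpace

end L2

theorem mem_ellTwo_of_finite_support {f : V → ℝ} (hf : (Function.support f).Finite) :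
    f ∈ G.ellTwo :=
  summable_of_hasFiniteSupport (hf.subset fun x hx => by
    contrapose! hx
    simp [Function.notMem_support.1 hx])

/-- The finitely supported functions in `ℓ²(V, m)`. -/
def finSupp : Submodule ℝ G.L2 where
  carrier := {φ | (Function.support (φ : V → ℝ)).Finite}
  zero_mem' := by
    change (Function.support (0 : V → ℝ)).Finite
    simp
  add_mem' hf hg := (hf.union hg).subset (Function.support_add _ _)
  smul_mem' a _ hf := hf.subset (Function.support_const_smul_subset a _)

open Classical in
/-- The indicator function of a vertex. -/
def delta (x : V) : G.L2 :=
  ⟨Pi.single x 1, G.mem_ellTwo_of_finite_support ((Set.finite_singleton x).subset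
    Pi.support_single_subset)⟩

theorem delta_mem (x : V) : G.delta x ∈ G.finSupp := by
  classical
  change (Function.support (Pi.single x 1 : V → ℝ)).Finite
  exact (Set.finite_singleton x).subset Pi.support_single_subset

theorem inner_delta (f : G.L2) (x : V) : inner ℝ f (G.delta x) = f x * G.m x := by
  classical
  rw [L2.inner_eq, tsum_eq_single x]
  · simp [delta]
  · intro y hy
    simp [delta, hy]

theorem eq_of_inner_finSupp {f g : G.L2} (h : ∀ φ ∈ G.finSupp, inner ℝ f φ = inner ℝ g φ) :
    f = g := by
  ext x
  have h1 := h _ (G.delta_mem x)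
  rw [inner_delta, inner_delta] at h1
  exact mul_right_cancel₀ (G.m_pos x).ne' h1

theorem dense_finSupp : Dense (G.finSupp : Set G.L2) := by
  rw [Submodule.dense_iff_topologicalClosure_eq_top, Submodule.topologicalClosure_eq_top_iff,
    Submodule.eq_bot_iff]
  intro f hf
  refine G.eq_of_inner_finSupp fun φ hφ => ?_
  rw [inner_zero_left, real_inner_comm]
  exact hf φ hφ

/-! ### The form as an inner product in an `ℓ²` space -/

/-- The coordinates whose square sum is the energy. -/
def energyCoord (f : V → ℝ) : (V × V) ⊕ V → ℝ :=
  Sum.elim (fun p => √(G.b p.1 p.2 / 2) * (f p.1 - f p.2)) fun x => √(G.c x) * f x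

theorem memℓp_energyCoord {f : V → ℝ} (hf : G.HasFiniteEnergy f) :
    Memℓp (G.energyCoord f) 2 := by
  rw [memℓp_gen_iff (by norm_num)]
  have h1 : Summable fun p : V × V => ‖G.energyCoord f (Sum.inl p)‖ ^ (2 : ENNReal).toReal := by
    refine (hf.1.div_const 2).congr fun p => ?_
    rw [ENNReal.toReal_ofNat, Real.rpow_two, Real.norm_eq_abs, sq_abs]
    simp only [energyCoord, Sum.elim_inl]
    rw [mul_pow, Real.sq_sqrt (div_nonneg (G.b_nonneg _ _) two_pos.le)]
    ring
  have h2 : Summable fun x : V => ‖G.energyCoord f (Sum.inr x)‖ ^ (2 : ENNReal).toReal := by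
    refine hf.2.congr fun p => ?_
    rw [ENNReal.toReal_ofNat, Real.rpow_two, Real.norm_eq_abs, sq_abs]
    simp only [energyCoord, Sum.elim_inr]
    rw [mul_pow, Real.sq_sqrt (G.c_nonneg _)]
  exact (HasSum.sum (f := fun i => ‖G.energyCoord f i‖ ^ (2 : ENNReal).toReal) h1.hasSum
    h2.hasSum).summable

theorem hasFiniteEnergy_of_memℓp {f : V → ℝ} (hf : Memℓp (G.energyCoord f) 2) :
    G.HasFiniteEnergy f := by
  rw [memℓp_gen_iff (by norm_num)] at hf
  constructor
  · refine ((hf.comp_injective Sum.inl_injective).mul_right 2).congr fun p => ?_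
    simp only [Function.comp_apply, energyCoord, Sum.elim_inl]
    rw [ENNReal.toReal_ofNat, Real.rpow_two, Real.norm_eq_abs, sq_abs, mul_pow,
      Real.sq_sqrt (div_nonneg (G.b_nonneg _ _) two_pos.le)]
    ring
  · refine (hf.comp_injective Sum.inr_injective).congr fun p => ?_
    simp only [Function.comp_apply, energyCoord, Sum.elim_inr]
    rw [ENNReal.toReal_ofNat, Real.rpow_two, Real.norm_eq_abs, sq_abs, mul_pow,
      Real.sq_sqrt (G.c_nonneg _)]

theorem energyCoord_add (f g : V → ℝ) :
    G.energyCoord (f + g) = G.energyCoord f + G.energyCoord g := by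
  funext i
  rcases i with p | x <;> simp only [energyCoord, Sum.elim_inl, Sum.elim_inr, Pi.add_apply] <;>
    ring

theorem energyCoord_smul (a : ℝ) (f : V → ℝ) :
    G.energyCoord (a • f) = a • G.energyCoord f := by
  funext i
  rcases i with p | x <;>
    simp only [energyCoord, Sum.elim_inl, Sum.elim_inr, Pi.smul_apply, smul_eq_mul] <;> ring

/-- The square summable functions of finite energy. -/
def energySpace : Submodule ℝ G.L2 where
  carrier := {f | G.HasFiniteEnergy f}
  zero_mem' := by
    change G.HasFiniteEnergy (0 : V → ℝ)
    simp [HasFiniteEnergy, summable_zero]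
  add_mem' {f g} hf hg := by
    refine G.hasFiniteEnergy_of_memℓp ?_
    change Memℓp (G.energyCoord ((f : V → ℝ) + g)) 2
    rw [energyCoord_add]
    exact (G.memℓp_energyCoord hf).add (G.memℓp_energyCoord hg)
  smul_mem' a f hf := by
    refine G.hasFiniteEnergy_of_memℓp ?_
    change Memℓp (G.energyCoord (a • (f : V → ℝ))) 2
    rw [energyCoord_smul]
    exact (G.memℓp_energyCoord hf).const_smul a

/-- Only edges meeting the support contribute, and local finiteness leaves finitely many of them. -/
theorem finSupp_le_energySpace : G.finSupp ≤ G.energySpace := by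
  intro φ hφ
  constructor
  · refine summable_of_hasFiniteSupport ?_
    refine ((hφ.biUnion fun x _ => (G.locallyFinite x).image fun y => (x, y)).union
      (hφ.biUnion fun x _ => (G.locallyFinite x).image fun y => (y, x))).subset ?_
    rintro ⟨x, y⟩ h
    simp only [Function.mem_support, ne_eq, mul_eq_zero, not_or] at h
    have hb : 0 < G.b x y := (G.b_nonneg x y).lt_of_ne' h.1
    by_cases hx : φ x = 0
    · have hy : φ y ≠ 0 := fun hy => h.2 (by simp [hx, hy])
      exact Or.inr (Set.mem_biUnion (x := y) hy ⟨x, by rwa [Set.mem_ofPred_eq, G.b_symm], rfl⟩)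
    · exact Or.inl (Set.mem_biUnion (x := x) hx ⟨y, hb, rfl⟩)
  · refine summable_of_hasFiniteSupport (hφ.subset fun x hx => ?_)
    contrapose! hx
    simp [Function.notMem_support.1 hx]

/-- The Hilbert space carrying the graph of the energy coordinates. -/
abbrev EnergyHilbert : Type _ := WithLp 2 (G.L2 × lp (fun _ : (V × V) ⊕ V => ℝ) 2)

/-- `f ↦ (f, energy coordinates of f)`. -/
def energyGraph : G.energySpace →ₗ[ℝ] G.EnergyHilbert where
  toFun f := WithLp.toLp 2 (f.1, ⟨G.energyCoord f.1, G.memℓp_energyCoord f.2⟩)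
  map_add' f g := by
    refine congrArg (WithLp.toLp 2) (Prod.ext rfl (Subtype.ext ?_))
    exact G.energyCoord_add f.1 g.1
  map_smul' a f := by
    refine congrArg (WithLp.toLp 2) (Prod.ext rfl (Subtype.ext ?_))
    exact G.energyCoord_smul a f.1

/-- The projection to `ℓ²(V, m)`. -/
def energyFst : G.EnergyHilbert →L[ℝ] G.L2 := WithLp.fstL 2 ℝ _ _

@[simp] theorem energyFst_energyGraph (f : G.energySpace) :
    G.energyFst (G.energyGraph f) = f.1 := rfl

theorem form_eq_tsum (f g : G.energySpace) :
    G.form f.1 g.1 = ∑' i, G.energyCoord f.1 i * G.energyCoord g.1 i := by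
  have h : Summable fun i => G.energyCoord f.1 i * G.energyCoord g.1 i := by
    have := lp.summable_inner (𝕜 := ℝ) (G.energyGraph g).snd (G.energyGraph f).snd
    exact this
  have h1 := h.comp_injective Sum.inl_injective
  have h2 := h.comp_injective Sum.inr_injective
  rw [(h1.hasSum.sum h2.hasSum).tsum_eq, form, ← tsum_mul_left]
  congr 1
  · refine tsum_congr fun p => ?_
    simp only [Function.comp_apply, energyCoord, Sum.elim_inl]
    rw [mul_mul_mul_comm, Real.mul_self_sqrt (div_nonneg (G.b_nonneg _ _) two_pos.le)]
    ring
  · refine tsum_congr fun x => ?_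
    simp only [Function.comp_apply, energyCoord, Sum.elim_inr]
    rw [mul_mul_mul_comm, Real.mul_self_sqrt (G.c_nonneg _), mul_assoc]

theorem inner_energyGraph (f g : G.energySpace) :
    inner ℝ (G.energyGraph f) (G.energyGraph g) = inner ℝ f.1 g.1 + G.form f.1 g.1 := by
  rw [WithLp.prod_inner_apply, form_eq_tsum, lp.inner_eq_tsum]
  congr 1
  exact tsum_congr fun i => mul_comm _ _

theorem norm_sq_energyGraph (f : G.energySpace) :
    ‖G.energyGraph f‖ ^ 2 = ‖f.1‖ ^ 2 + G.form f.1 f.1 := by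
  rw [← real_inner_self_eq_norm_sq, inner_energyGraph, real_inner_self_eq_norm_sq]

theorem form_comm (f g : V → ℝ) : G.form f g = G.form g f := by
  unfold form
  congr 1
  · congr 1
    exact tsum_congr fun p => by ring
  · exact tsum_congr fun p => by ring

theorem form_self_nonneg (f : V → ℝ) : 0 ≤ G.form f f := by
  refine add_nonneg (mul_nonneg (by norm_num) (tsum_nonneg fun p => ?_)) (tsum_nonneg fun x => ?_)
  · rw [mul_assoc]
    exact mul_nonneg (G.b_nonneg _ _) (mul_self_nonneg _)
  · rw [mul_assoc]
    exact mul_nonneg (G.c_nonneg _) (mul_self_nonneg _)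

/-- The form domain, as a closed subspace of the energy Hilbert space. -/
def formSpace : Submodule ℝ G.EnergyHilbert :=
  ((G.finSupp.comap G.energySpace.subtype).map G.energyGraph).topologicalClosure

theorem isClosed_formSpace : IsClosed (G.formSpace : Set G.EnergyHilbert) :=
  Submodule.isClosed_topologicalClosure _

theorem energyGraph_mem_formSpace {φ : G.L2} (hφ : φ ∈ G.finSupp) :
    G.energyGraph ⟨φ, G.finSupp_le_energySpace hφ⟩ ∈ G.formSpace :=
  Submodule.le_topologicalClosure _ ⟨_, hφ, rfl⟩

/-- A closed condition that holds on finitely supported functions holds on the form space. -/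
theorem formSpace_induction {p : G.EnergyHilbert → Prop} (hp : IsClosed {u | p u})
    (h : ∀ (φ : G.L2) (hφ : φ ∈ G.finSupp), p (G.energyGraph ⟨φ, G.finSupp_le_energySpace hφ⟩))
    {u : G.EnergyHilbert} (hu : u ∈ G.formSpace) : p u := by
  refine closure_minimal (t := {u | p u}) ?_ hp hu
  rintro _ ⟨⟨φ, _⟩, hφ, rfl⟩
  exact h φ hφ

/-- Closability of `Q`. Each energy coordinate depends on at most two values of `f`, and evaluation
is continuous on `ℓ²(V, m)`, so a limit of energy graphs is again an energy graph. -/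
theorem eq_energyGraph_of_mem {u : G.EnergyHilbert} (hu : u ∈ G.formSpace) :
    ∃ f : G.energySpace, u = G.energyGraph f := by
  have h1 : ∀ i, u.snd i = G.energyCoord u.fst i := by
    intro i
    refine G.formSpace_induction (p := fun u => u.snd i = G.energyCoord u.fst i) ?_
      (fun _ _ => rfl) hu
    have hs : Continuous fun u : G.EnergyHilbert => u.snd i :=
      (lp.evalCLM ℝ (fun _ : (V × V) ⊕ V => ℝ) 2 i).continuous.comp
        (WithLp.sndL 2 ℝ G.L2 _).continuous
    have he : ∀ x, Continuous fun u : G.EnergyHilbert => (u.fst : V → ℝ) x :=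
      fun x => (L2.eval x).continuous.comp (WithLp.fstL 2 ℝ G.L2 _).continuous
    refine isClosed_eq hs ?_
    rcases i with p | x
    · exact ((he p.1).sub (he p.2)).const_mul _
    · exact (he x).const_mul _
  have h2 : G.HasFiniteEnergy u.fst := by
    refine G.hasFiniteEnergy_of_memℓp ?_
    rw [← funext h1]
    exact u.snd.2
  refine ⟨⟨u.fst, h2⟩, ?_⟩
  refine congrArg (WithLp.toLp 2) (Prod.ext rfl (Subtype.ext (funext h1)))

theorem mem_formDomain_iff {f : G.L2} :
    f ∈ G.formDomain ↔ ∃ hf : f ∈ G.energySpace, G.energyGraph ⟨f, hf⟩ ∈ G.formSpace := by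
  constructor
  · rintro ⟨hf, h⟩
    refine ⟨hf, Metric.mem_closure_iff.2 fun ε hε => ?_⟩
    obtain ⟨φ, hφ, h1⟩ := h (ε ^ 2) (by positivity)
    refine ⟨_, ⟨⟨φ, G.finSupp_le_energySpace hφ⟩, hφ, rfl⟩, ?_⟩
    rw [dist_eq_norm, ← map_sub]
    refine lt_of_pow_lt_pow_left₀ 2 hε.le ?_
    rw [norm_sq_energyGraph]
    exact h1
  · rintro ⟨hf, h⟩
    refine ⟨hf, fun ε hε => ?_⟩
    obtain ⟨_, ⟨⟨φ, hφ'⟩, hφ, rfl⟩, h1⟩ := Metric.mem_closure_iff.1 h (√ε) (Real.sqrt_pos.2 hε)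
    refine ⟨φ, hφ, ?_⟩
    rw [dist_eq_norm, ← map_sub, Real.lt_sqrt (norm_nonneg _), norm_sq_energyGraph] at h1
    exact h1

theorem mem_formDomain_of_mem_formSpace {f : G.L2} (hf : f ∈ G.energySpace)
    (h : G.energyGraph ⟨f, hf⟩ ∈ G.formSpace) : f ∈ G.formDomain :=
  G.mem_formDomain_iff.2 ⟨hf, h⟩

theorem finSupp_subset_formDomain {φ : G.L2} (hφ : φ ∈ G.finSupp) : φ ∈ G.formDomain :=
  G.mem_formDomain_of_mem_formSpace _ (G.energyGraph_mem_formSpace hφ)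

/-! ### The Laplacian on finitely supported functions -/

/-- The formal Laplacian. -/
def formalLaplacian (f : V → ℝ) (x : V) : ℝ :=
  (1 / G.m x) * (∑ᶠ y, G.b x y * (f x - f y) + G.c x * f x)

/-- Support of a function together with its neighbours. -/
theorem finite_neighbourhood {φ : V → ℝ} (hφ : (Function.support φ).Finite) :
    (Function.support φ ∪ ⋃ x ∈ Function.support φ, {y | 0 < G.b x y}).Finite :=
  hφ.union (hφ.biUnion fun x _ => G.locallyFinite x)

theorem exists_finset_neighbourhood {φ : V → ℝ} (hφ : (Function.support φ).Finite) :
    ∃ F : Finset V, (∀ x ∉ F, φ x = 0) ∧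
      ∀ x y, G.b x y * (φ x - φ y) ≠ 0 → x ∈ F ∧ y ∈ F := by
  refine ⟨(G.finite_neighbourhood hφ).toFinset, fun x hx => ?_, fun x y h => ?_⟩
  · by_contra h
    exact hx ((G.finite_neighbourhood hφ).mem_toFinset.2 (Or.inl h))
  · simp only [Set.Finite.mem_toFinset]
    obtain ⟨hb, hd⟩ := mul_ne_zero_iff.1 h
    have hb1 : 0 < G.b x y := (G.b_nonneg x y).lt_of_ne' hb
    have hb2 : 0 < G.b y x := by rwa [G.b_symm]
    by_cases hx : φ x = 0
    · have hy : φ y ≠ 0 := fun hy => hd (by simp [hx, hy])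
      exact ⟨Or.inr (Set.mem_biUnion (x := y) hy hb2), Or.inl hy⟩
    · exact ⟨Or.inl hx, Or.inr (Set.mem_biUnion (x := x) hx hb1)⟩

theorem formalLaplacian_eq_sum {φ : V → ℝ} {F : Finset V}
    (hF : ∀ x y, G.b x y * (φ x - φ y) ≠ 0 → x ∈ F ∧ y ∈ F) (x : V) :
    G.formalLaplacian φ x = (1 / G.m x) * (∑ y ∈ F, G.b x y * (φ x - φ y) + G.c x * φ x) := by
  rw [formalLaplacian, finsum_eq_sum_of_support_subset _ fun y hy => (hF x y hy).2]

theorem formalLaplacian_eq_zero {φ : V → ℝ} {F : Finset V} (h0 : ∀ x ∉ F, φ x = 0)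
    (hF : ∀ x y, G.b x y * (φ x - φ y) ≠ 0 → x ∈ F ∧ y ∈ F) {x : V} (hx : x ∉ F) :
    G.formalLaplacian φ x = 0 := by
  have h : ∑ y ∈ F, G.b x y * (φ x - φ y) = 0 := Finset.sum_eq_zero fun y _ => by
    by_contra h
    exact hx (hF x y h).1
  rw [G.formalLaplacian_eq_sum hF, h, h0 x hx, mul_zero, add_zero, mul_zero]

theorem formalLaplacian_support_finite {φ : V → ℝ} (hφ : (Function.support φ).Finite) :
    (Function.support (G.formalLaplacian φ)).Finite := by
  obtain ⟨F, h0, hF⟩ := G.exists_finset_neighbourhood hφ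
  refine F.finite_toSet.subset fun x hx => ?_
  by_contra h
  exact hx (G.formalLaplacian_eq_zero h0 hF h)

/-- Green's formula. -/
theorem form_eq_tsum_formalLaplacian (f : V → ℝ) {φ : V → ℝ}
    (hφ : (Function.support φ).Finite) :
    G.form f φ = ∑' x, f x * G.formalLaplacian φ x * G.m x := by
  obtain ⟨F, h0, hF⟩ := G.exists_finset_neighbourhood hφ
  rw [tsum_eq_sum (s := F) fun x hx => by rw [G.formalLaplacian_eq_zero h0 hF hx]; ring, form,
    tsum_eq_sum (s := F ×ˢ F), tsum_eq_sum (s := F) fun x hx => by rw [h0 x hx, mul_zero],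
    Finset.sum_product]
  · have h1 : ∑ x ∈ F, ∑ y ∈ F, G.b x y * (f x - f y) * (φ x - φ y)
        = 2 * ∑ x ∈ F, ∑ y ∈ F, f x * (G.b x y * (φ x - φ y)) := by
      -- Interchanging `x` and `y` preserves `b` and reverses the sign of `φ x - φ y`.
      have h2 : ∑ x ∈ F, ∑ y ∈ F, f y * (G.b x y * (φ x - φ y))
          = -∑ x ∈ F, ∑ y ∈ F, f x * (G.b x y * (φ x - φ y)) := by
        rw [Finset.sum_comm, ← Finset.sum_neg_distrib]
        refine Finset.sum_congr rfl fun x _ => ?_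
        rw [← Finset.sum_neg_distrib]
        refine Finset.sum_congr rfl fun y _ => ?_
        rw [G.b_symm y x]
        ring
      have h3 : ∑ x ∈ F, ∑ y ∈ F, G.b x y * (f x - f y) * (φ x - φ y)
          = ∑ x ∈ F, ∑ y ∈ F, f x * (G.b x y * (φ x - φ y))
            - ∑ x ∈ F, ∑ y ∈ F, f y * (G.b x y * (φ x - φ y)) := by
        rw [← Finset.sum_sub_distrib]
        refine Finset.sum_congr rfl fun x _ => ?_
        rw [← Finset.sum_sub_distrib]
        exact Finset.sum_congr rfl fun y _ => by ring
      rw [h3, h2]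
      ring
    rw [h1, ← mul_assoc, one_div_mul_cancel two_ne_zero, one_mul, ← Finset.sum_add_distrib]
    refine Finset.sum_congr rfl fun x _ => ?_
    rw [G.formalLaplacian_eq_sum hF, ← Finset.mul_sum]
    have := (G.m_pos x).ne'
    field_simp
  · rintro ⟨x, y⟩ h
    by_contra h1
    refine h (Finset.mem_product.2 (hF x y ?_))
    intro h2
    apply h1
    linear_combination (f x - f y) * h2

/-- The formal Laplacian of a finitely supported function, as an element of `ℓ²(V, m)`. -/
def laplacianL2 (φ : G.L2) (hφ : φ ∈ G.finSupp) : G.L2 :=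
  ⟨G.formalLaplacian φ, G.mem_ellTwo_of_finite_support (G.formalLaplacian_support_finite hφ)⟩

theorem form_eq_inner (f : G.L2) {φ : G.L2} (hφ : φ ∈ G.finSupp) :
    G.form f φ = inner ℝ f (G.laplacianL2 φ hφ) :=
  G.form_eq_tsum_formalLaplacian f hφ

theorem isLaplacian_of_mem_finSupp {φ : G.L2} (hφ : φ ∈ G.finSupp) :
    G.IsLaplacian φ (G.laplacianL2 φ hφ) := by
  refine ⟨G.finSupp_subset_formDomain hφ, fun h _ => ?_⟩
  rw [form_comm, form_eq_inner, real_inner_comm]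

/-- Both sides of the defining identity are continuous in `h` for the energy norm, so finitely
supported tests suffice. Green's formula then moves the operator onto the test function. -/
theorem isLaplacian_iff {f g : G.L2} :
    G.IsLaplacian f g ↔ f ∈ G.formDomain ∧
      ∀ (φ : G.L2) (hφ : φ ∈ G.finSupp), inner ℝ f (G.laplacianL2 φ hφ) = inner ℝ g φ := by
  refine and_congr_right fun hf => ⟨fun h φ hφ => ?_, fun h ψ hψ => ?_⟩
  · rw [← form_eq_inner]
    exact h φ (G.finSupp_subset_formDomain hφ)
  · obtain ⟨hf1, hf2⟩ := G.mem_formDomain_iff.1 hf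
    obtain ⟨hψ1, hψ2⟩ := G.mem_formDomain_iff.1 hψ
    have h1 : inner ℝ (G.energyGraph ⟨f, hf1⟩) (G.energyGraph ⟨ψ, hψ1⟩)
        = inner ℝ f ψ + inner ℝ g ψ := by
      refine G.formSpace_induction (p := fun u => inner ℝ (G.energyGraph ⟨f, hf1⟩) u
        = inner ℝ f (G.energyFst u) + inner ℝ g (G.energyFst u)) ?_ ?_ hψ2
      · exact isClosed_eq (by fun_prop) (by fun_prop)
      · intro φ hφ
        rw [inner_energyGraph, energyFst_energyGraph, ← h φ hφ, ← form_eq_inner]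
    rw [inner_energyGraph] at h1
    exact add_left_cancel h1

/-! ### The Laplacian as a maximal monotone operator -/

theorem formDomain_add {f g : G.L2} (hf : f ∈ G.formDomain) (hg : g ∈ G.formDomain) :
    f + g ∈ G.formDomain := by
  obtain ⟨hf1, hf2⟩ := G.mem_formDomain_iff.1 hf
  obtain ⟨hg1, hg2⟩ := G.mem_formDomain_iff.1 hg
  have h := G.formSpace.add_mem hf2 hg2
  rw [← map_add] at h
  exact G.mem_formDomain_of_mem_formSpace (G.energySpace.add_mem hf1 hg1) h

theorem formDomain_smul (a : ℝ) {f : G.L2} (hf : f ∈ G.formDomain) : a • f ∈ G.formDomain := by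
  obtain ⟨hf1, hf2⟩ := G.mem_formDomain_iff.1 hf
  have h := G.formSpace.smul_mem a hf2
  rw [← map_smul] at h
  exact G.mem_formDomain_of_mem_formSpace (G.energySpace.smul_mem a hf1) h

/-- The graph of the Laplacian. -/
def laplacianGraph : Submodule ℝ (G.L2 × G.L2) where
  carrier := {p | G.IsLaplacian p.1 p.2}
  zero_mem' := by
    refine G.isLaplacian_iff.2 ⟨G.finSupp_subset_formDomain G.finSupp.zero_mem, fun φ hφ => ?_⟩
    simp
  add_mem' {p q} hp hq := by
    have hp1 := G.isLaplacian_iff.1 hp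
    have hq1 := G.isLaplacian_iff.1 hq
    refine G.isLaplacian_iff.2 ⟨G.formDomain_add hp1.1 hq1.1, fun φ hφ => ?_⟩
    rw [Prod.fst_add, Prod.snd_add, inner_add_left, inner_add_left, hp1.2 φ hφ, hq1.2 φ hφ]
  smul_mem' a p hp := by
    have hp1 := G.isLaplacian_iff.1 hp
    refine G.isLaplacian_iff.2 ⟨G.formDomain_smul a hp1.1, fun φ hφ => ?_⟩
    rw [Prod.smul_fst, Prod.smul_snd, real_inner_smul_left, real_inner_smul_left, hp1.2 φ hφ]

theorem mem_laplacianGraph {f g : G.L2} : (f, g) ∈ G.laplacianGraph ↔ G.IsLaplacian f g :=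
  Iff.rfl

theorem exists_laplacian_resolvent (n : ℕ) (g : G.L2) :
    ∃ f, G.IsLaplacian f (((n : ℝ) + 1) • (g - f)) := by
  have : CompleteSpace G.formSpace := G.isClosed_formSpace.completeSpace_coe
  let F : G.formSpace →L[ℝ] G.L2 := G.energyFst.comp G.formSpace.subtypeL
  -- The equation is `Q(f, h) + (n+1)⟨f, h⟩ = (n+1)⟨g, h⟩`. The inner product of the form space
  -- already contains one `⟨f, h⟩`, so the shift is `n`.
  obtain ⟨u, hu⟩ := exists_inner_add_inner_eq F n.cast_nonneg (((n : ℝ) + 1) • g)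
  obtain ⟨f, hf⟩ := G.eq_energyGraph_of_mem u.2
  have hFu : F u = f.1 := by
    change G.energyFst u.1 = _
    rw [hf, energyFst_energyGraph]
  refine ⟨f.1, G.mem_formDomain_of_mem_formSpace f.2 (hf ▸ u.2), fun h hh => ?_⟩
  obtain ⟨hh1, hh2⟩ := G.mem_formDomain_iff.1 hh
  have h1 := hu ⟨_, hh2⟩
  have h2 : inner ℝ u (⟨_, hh2⟩ : G.formSpace) = inner ℝ f.1 h + G.form f.1 h := by
    rw [Submodule.coe_inner, hf, inner_energyGraph]
  have h3 : F ⟨_, hh2⟩ = h := rfl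
  rw [h2, h3, hFu, real_inner_smul_left] at h1
  rw [real_inner_smul_left, inner_sub_left]
  linarith

theorem isMaximalMonotone_laplacianGraph : IsMaximalMonotone G.laplacianGraph where
  inner_nonneg f g h := by
    rw [← (G.mem_laplacianGraph.1 h).2 f h.1]
    exact G.form_self_nonneg f
  exists_resolvent n g := G.exists_laplacian_resolvent n g
  dense := G.dense_finSupp.mono fun _ hφ => ⟨_, G.isLaplacian_of_mem_finSupp hφ⟩

theorem isHeatSemigroup_semigroup :
    G.IsHeatSemigroup G.isMaximalMonotone_laplacianGraph.semigroup where
  zero := IsMaximalMonotone.semigroup_zero _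
  add := IsMaximalMonotone.semigroup_add _
  continuous := IsMaximalMonotone.continuous_semigroup _
  generator := IsMaximalMonotone.tendsto_generator_iff _

end WeightedGraph
end

noncomputable section

namespace WeightedGraph

variable {V : Type*} (G : WeightedGraph V)

/-! ### Averaging as a symmetric contraction -/

/-- The sphere `S_r(x₀)` as a finset. -/
def sphereFinset (x₀ : V) (r : ℕ) : Finset V := (G.sphere_finite x₀ r).toFinset

@[simp] theorem mem_sphereFinset {x₀ : V} {r : ℕ} {x : V} :
    x ∈ G.sphereFinset x₀ r ↔ G.dist x₀ x = r :=
  (G.sphere_finite x₀ r).mem_toFinset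

theorem average_eq (x₀ : V) (f : V → ℝ) (x : V) :
    G.average x₀ f x = (1 / ∑ y ∈ G.sphereFinset x₀ (G.dist x₀ x), G.m y) *
      ∑ y ∈ G.sphereFinset x₀ (G.dist x₀ x), f y * G.m y := by
  rw [average, finsum_mem_eq_finite_toFinset_sum _ (G.sphere_finite x₀ _),
    finsum_mem_eq_finite_toFinset_sum _ (G.sphere_finite x₀ _)]
  rfl

theorem isSphericallySymmetric_iff {x₀ : V} {f : V → ℝ} :
    G.IsSphericallySymmetric x₀ f ↔ ∀ x y, G.dist x₀ x = G.dist x₀ y → f x = f y := by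
  constructor
  · rintro ⟨g, hg⟩ x y h
    rw [hg _ x h, hg _ y rfl]
  · intro h
    classical
    refine ⟨fun r => if hr : ∃ x, G.dist x₀ x = r then f hr.choose else 0, fun r x hx => ?_⟩
    have hr : ∃ x, G.dist x₀ x = r := ⟨x, hx⟩
    refine Eq.trans ?_ (dif_pos hr).symm
    exact h _ _ (hr.choose_spec.symm ▸ hx)

theorem isSphericallySymmetric_average (x₀ : V) (f : V → ℝ) :
    G.IsSphericallySymmetric x₀ (G.average x₀ f) :=
  G.isSphericallySymmetric_iff.2 fun x y h => by rw [average, average, h]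

theorem average_of_isSphericallySymmetric {x₀ : V} {f : V → ℝ}
    (hf : G.IsSphericallySymmetric x₀ f) : G.average x₀ f = f := by
  funext x
  rw [isSphericallySymmetric_iff] at hf
  have hM : 0 < ∑ y ∈ G.sphereFinset x₀ (G.dist x₀ x), G.m y :=
    Finset.sum_pos (fun y _ => G.m_pos y) ⟨x, G.mem_sphereFinset.2 rfl⟩
  have h : ∑ y ∈ G.sphereFinset x₀ (G.dist x₀ x), f y * G.m y
      = ∑ y ∈ G.sphereFinset x₀ (G.dist x₀ x), f x * G.m y :=
    Finset.sum_congr rfl fun y hy => by rw [hf y x (G.mem_sphereFinset.1 hy)]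
  rw [average_eq, h, ← Finset.mul_sum]
  field_simp

theorem tsum_eq_tsum_sphere (x₀ : V) {h : V → ℝ} (hh : Summable h) :
    ∑' x, h x = ∑' r, ∑ x ∈ G.sphereFinset x₀ r, h x := by
  have h1 := (Equiv.summable_iff (Equiv.sigmaFiberEquiv (G.dist x₀))).2 hh
  rw [← (Equiv.sigmaFiberEquiv (G.dist x₀)).tsum_eq]
  refine (Summable.tsum_sigma h1).trans ?_
  refine tsum_congr fun r => ?_
  rw [← Finset.tsum_subtype' (G.sphereFinset x₀ r) h]
  have h2 : ((G.sphereFinset x₀ r : Finset V) : Set V) = {x | G.dist x₀ x = r} := by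
    ext x
    simp
  rw [h2]
  rfl

/-- The right-hand side is symmetric in `f` and `h`, which makes averaging self-adjoint sphere by
sphere. -/
theorem sum_average_mul (x₀ : V) (f h : V → ℝ) (r : ℕ) :
    ∑ x ∈ G.sphereFinset x₀ r, G.average x₀ f x * h x * G.m x
      = (1 / ∑ y ∈ G.sphereFinset x₀ r, G.m y) * (∑ y ∈ G.sphereFinset x₀ r, f y * G.m y) *
        ∑ y ∈ G.sphereFinset x₀ r, h y * G.m y := by
  rw [Finset.mul_sum]
  refine Finset.sum_congr rfl fun x hx => ?_
  rw [average_eq, G.mem_sphereFinset.1 hx, mul_assoc]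

theorem inner_averageL2_left (x₀ : V) (f g : G.L2) :
    inner ℝ (G.averageL2 x₀ f) g = inner ℝ f (G.averageL2 x₀ g) := by
  rw [real_inner_comm _ f, L2.inner_eq, L2.inner_eq,
    G.tsum_eq_tsum_sphere x₀ (G.summable_mul (L2.summable_sq _) (L2.summable_sq _)),
    G.tsum_eq_tsum_sphere x₀ (G.summable_mul (L2.summable_sq _) (L2.summable_sq _))]
  refine tsum_congr fun r => ?_
  refine (G.sum_average_mul x₀ f g r).trans (Eq.trans ?_ (G.sum_average_mul x₀ g f r).symm)
  ring

theorem averageL2_eq_self {x₀ : V} {f : G.L2} (hf : G.IsSphericallySymmetric x₀ f) :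
    G.averageL2 x₀ f = f :=
  Subtype.ext (G.average_of_isSphericallySymmetric hf)

theorem averageL2_averageL2 (x₀ : V) (f : G.L2) :
    G.averageL2 x₀ (G.averageL2 x₀ f) = G.averageL2 x₀ f :=
  G.averageL2_eq_self (G.isSphericallySymmetric_average x₀ f)

theorem norm_averageL2_le (x₀ : V) (f : G.L2) : ‖G.averageL2 x₀ f‖ ≤ ‖f‖ := by
  have h := real_inner_le_norm f (G.averageL2 x₀ f)
  rw [← averageL2_averageL2, ← inner_averageL2_left, averageL2_averageL2,
    real_inner_self_eq_norm_sq] at h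
  by_contra! hlt
  nlinarith [norm_nonneg f]

/-- The averaging operator as a bounded operator. -/
def averageCLM (x₀ : V) : G.L2 →L[ℝ] G.L2 :=
  LinearMap.mkContinuous
    { toFun := G.averageL2 x₀
      -- Linearity follows from self-adjointness alone.
      map_add' := fun f g => ext_inner_right ℝ fun h => by
        rw [inner_averageL2_left, inner_add_left, inner_add_left, inner_averageL2_left,
          inner_averageL2_left]
      map_smul' := fun a f => ext_inner_right ℝ fun h => by
        rw [RingHom.id_apply, inner_averageL2_left, real_inner_smul_left, real_inner_smul_left,
          inner_averageL2_left] }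
    1 fun f => by
      rw [one_mul]
      exact G.norm_averageL2_le x₀ f

@[simp] theorem averageCLM_apply (x₀ : V) (f : G.L2) :
    G.averageCLM x₀ f = G.averageL2 x₀ f := rfl

theorem averageL2_mem_finSupp (x₀ : V) {φ : G.L2} (hφ : φ ∈ G.finSupp) :
    G.averageL2 x₀ φ ∈ G.finSupp := by
  refine (hφ.biUnion fun y _ => G.sphere_finite x₀ (G.dist x₀ y)).subset fun x hx => ?_
  have h1 : G.average x₀ φ x ≠ 0 := hx
  rw [average_eq] at h1
  obtain ⟨y, hy, h2⟩ := Finset.exists_ne_zero_of_sum_ne_zero (right_ne_zero_of_mul h1)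
  exact Set.mem_biUnion (x := y) (left_ne_zero_of_mul h2) (G.mem_sphereFinset.1 hy).symm

/-! ### The Laplacian of a spherically symmetric function -/

theorem dist_le_succ {x₀ x y : V} (h : 0 < G.b x y) : G.dist x₀ y ≤ G.dist x₀ x + 1 := by
  have h1 := (G.graph_connected x₀ x).dist_triangle_left y
  have h2 : G.graph.dist x y = 1 := SimpleGraph.dist_eq_one_iff_adj.2 h
  unfold dist
  omega

theorem b_eq_zero_of_notMem {x y : V} (h : y ∉ (G.locallyFinite x).toFinset) : G.b x y = 0 := by
  by_contra h1
  exact h ((G.locallyFinite x).mem_toFinset.2 ((G.b_nonneg x y).lt_of_ne' h1))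

open Classical in
theorem finsum_mem_b (x : V) (S : Set V) :
    ∑ᶠ y ∈ S, G.b x y = ∑ y ∈ (G.locallyFinite x).toFinset, if y ∈ S then G.b x y else 0 := by
  rw [finsum_mem_def, finsum_eq_sum_of_support_subset (s := (G.locallyFinite x).toFinset)]
  · exact Finset.sum_congr rfl fun y _ => Set.indicator_apply _ _ _
  · intro y hy
    by_contra h
    refine hy ?_
    rw [Set.indicator_apply, G.b_eq_zero_of_notMem h, ite_self]

/-- Neighbours of `x` lie on its own sphere, contributing zero, or on an adjacent one. At `x₀` the
truncated `0 - 1` is harmless, since there the inner curvature vanishes. -/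
theorem formalLaplacian_comp_dist (x₀ : V) (g : ℕ → ℝ) (x : V) :
    G.formalLaplacian (fun y => g (G.dist x₀ y)) x =
      G.outerCurvature x₀ x * (g (G.dist x₀ x) - g (G.dist x₀ x + 1)) +
      G.innerCurvature x₀ x * (g (G.dist x₀ x) - g (G.dist x₀ x - 1)) +
      G.normalizedPotential x * g (G.dist x₀ x) := by
  classical
  have h1 : ∑ᶠ y, G.b x y * (g (G.dist x₀ x) - g (G.dist x₀ y)) =
      (∑ᶠ y ∈ G.sphere x₀ (G.dist x₀ x + 1), G.b x y) *
        (g (G.dist x₀ x) - g (G.dist x₀ x + 1)) +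
      (∑ᶠ y ∈ {y | G.dist x₀ y + 1 = G.dist x₀ x}, G.b x y) *
        (g (G.dist x₀ x) - g (G.dist x₀ x - 1)) := by
    rw [finsum_mem_b, finsum_mem_b,
      finsum_eq_sum_of_support_subset (s := (G.locallyFinite x).toFinset), Finset.sum_mul,
      Finset.sum_mul, ← Finset.sum_add_distrib]
    · refine Finset.sum_congr rfl fun y hy => ?_
      have hb : 0 < G.b x y := (G.locallyFinite x).mem_toFinset.1 hy
      have h2 := G.dist_le_succ (x₀ := x₀) hb
      have h3 := G.dist_le_succ (x₀ := x₀) (x := y) (y := x) (by rwa [G.b_symm])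
      have hS : y ∈ G.sphere x₀ (G.dist x₀ x + 1) ↔ G.dist x₀ y = G.dist x₀ x + 1 := Iff.rfl
      rw [hS, Set.mem_ofPred_eq]
      rcases lt_trichotomy (G.dist x₀ y) (G.dist x₀ x) with h | h | h
      · have e : G.dist x₀ x = G.dist x₀ y + 1 := by omega
        rw [if_neg (by omega), if_pos e.symm, zero_mul, zero_add, e, Nat.add_sub_cancel]
      · rw [if_neg (by omega), if_neg (by omega), h]
        ring
      · have e : G.dist x₀ y = G.dist x₀ x + 1 := by omega
        rw [if_pos e, if_neg (by omega), zero_mul, add_zero, e]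
    · intro y hy
      by_contra h
      exact hy (by simp only [G.b_eq_zero_of_notMem h, zero_mul])
  rw [formalLaplacian, h1, outerCurvature, innerCurvature, normalizedPotential]
  ring

theorem innerCurvature_of_dist_eq_zero {x₀ x : V} (h : G.dist x₀ x = 0) :
    G.innerCurvature x₀ x = 0 := by
  simp [innerCurvature, h]

/-- If the Laplacian preserves the spherical symmetry of the indicators of the spheres, then the
curvatures and the potential are spherically symmetric. -/
theorem isWeaklySphericallySymmetric_of_formalLaplacian {x₀ : V}
    (h : ∀ r : ℕ, G.IsSphericallySymmetric x₀
      (G.formalLaplacian fun y => if G.dist x₀ y = r then 1 else 0)) :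
    G.IsWeaklySphericallySymmetric := by
  have key : ∀ r x y, G.dist x₀ x = G.dist x₀ y → _ := fun r =>
    G.isSphericallySymmetric_iff.1 (h r)
  have hk : ∀ (r : ℕ) (x : V), _ := fun r x =>
    G.formalLaplacian_comp_dist x₀ (fun k => if k = r then 1 else 0) x
  have hout : G.IsSphericallySymmetric x₀ (G.outerCurvature x₀) := by
    refine G.isSphericallySymmetric_iff.2 fun x y hxy => ?_
    -- On `S_r`, the Laplacian of the indicator of `S_{r+1}` is `-κ₊`. Below, the indicator of
    -- `S_{r-1}` gives `-κ₋`, and that of `S_r` gives `κ₊ + κ₋ + q`.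
    have h1 := key (G.dist x₀ x + 1) x y hxy
    rw [hk, hk, ← hxy] at h1
    have e1 : ¬ G.dist x₀ x - 1 = G.dist x₀ x + 1 := by omega
    have e2 : ¬ G.dist x₀ x = G.dist x₀ x + 1 := by omega
    simp only [e1, e2, if_false, if_true] at h1
    linarith
  have hin : G.IsSphericallySymmetric x₀ (G.innerCurvature x₀) := by
    refine G.isSphericallySymmetric_iff.2 fun x y hxy => ?_
    rcases Nat.eq_zero_or_pos (G.dist x₀ x) with h0 | h0
    · rw [G.innerCurvature_of_dist_eq_zero h0, G.innerCurvature_of_dist_eq_zero (hxy ▸ h0)]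
    have h1 := key (G.dist x₀ x - 1) x y hxy
    rw [hk, hk, ← hxy] at h1
    have e1 : ¬ G.dist x₀ x + 1 = G.dist x₀ x - 1 := by omega
    have e2 : ¬ G.dist x₀ x = G.dist x₀ x - 1 := by omega
    simp only [e1, e2, if_false, if_true] at h1
    linarith
  refine ⟨x₀, hout, hin, G.isSphericallySymmetric_iff.2 fun x y hxy => ?_⟩
  have h1 := key (G.dist x₀ x) x y hxy
  rw [hk, hk, ← hxy, G.isSphericallySymmetric_iff.1 hout x y hxy,
    G.isSphericallySymmetric_iff.1 hin x y hxy] at h1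
  simpa using h1

/-- With spherically symmetric curvatures and potential, the Laplacian preserves spherical
symmetry. -/
theorem isSphericallySymmetric_formalLaplacian {x₀ : V}
    (hout : G.IsSphericallySymmetric x₀ (G.outerCurvature x₀))
    (hin : G.IsSphericallySymmetric x₀ (G.innerCurvature x₀))
    (hq : G.IsSphericallySymmetric x₀ G.normalizedPotential) {f : V → ℝ}
    (hf : G.IsSphericallySymmetric x₀ f) :
    G.IsSphericallySymmetric x₀ (G.formalLaplacian f) := by
  obtain ⟨g, hg⟩ := hf
  obtain rfl : f = fun y => g (G.dist x₀ y) := funext fun y => hg _ y rfl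
  refine G.isSphericallySymmetric_iff.2 fun x y hxy => ?_
  rw [formalLaplacian_comp_dist, formalLaplacian_comp_dist,
    G.isSphericallySymmetric_iff.1 hout x y hxy, G.isSphericallySymmetric_iff.1 hin x y hxy,
    G.isSphericallySymmetric_iff.1 hq x y hxy, hxy]

/-! ### Averaging and the form -/

/-- The formal Laplacian maps spherically symmetric functions to spherically symmetric functions. -/
def PreservesSymmetry (x₀ : V) : Prop :=
  ∀ f : V → ℝ, G.IsSphericallySymmetric x₀ f → G.IsSphericallySymmetric x₀ (G.formalLaplacian f)

variable {x₀ : V}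

/-- `L A φ` is symmetric, hence fixed by `A`, so by Green's formula and self-adjointness `A` can be
moved onto `ψ`. -/
theorem form_averageL2_left (hs : G.PreservesSymmetry x₀) {φ ψ : G.L2}
    (hφ : φ ∈ G.finSupp) :
    G.form (G.averageL2 x₀ φ) ψ = G.form (G.averageL2 x₀ φ) (G.averageL2 x₀ ψ) := by
  have hA := G.averageL2_mem_finSupp x₀ hφ
  have h1 : G.averageL2 x₀ (G.laplacianL2 _ hA) = G.laplacianL2 _ hA :=
    G.averageL2_eq_self (hs _ (G.isSphericallySymmetric_average x₀ φ))
  rw [form_comm, G.form_comm _ (G.averageL2 x₀ ψ : V → ℝ), G.form_eq_inner _ hA,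
    G.form_eq_inner _ hA, inner_averageL2_left, h1]

theorem form_averageL2_comm (hs : G.PreservesSymmetry x₀) {φ ψ : G.L2} (hφ : φ ∈ G.finSupp)
    (hψ : ψ ∈ G.finSupp) :
    G.form (G.averageL2 x₀ φ) ψ = G.form φ (G.averageL2 x₀ ψ) := by
  rw [G.form_averageL2_left hs hφ, form_comm, ← G.form_averageL2_left hs hψ, form_comm]

theorem averageL2_laplacianL2 (hs : G.PreservesSymmetry x₀) {φ : G.L2} (hφ : φ ∈ G.finSupp) :
    G.averageL2 x₀ (G.laplacianL2 φ hφ)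
      = G.laplacianL2 _ (G.averageL2_mem_finSupp x₀ hφ) := by
  refine G.eq_of_inner_finSupp fun ψ hψ => ?_
  rw [inner_averageL2_left, real_inner_comm, ← form_eq_inner, real_inner_comm, ← form_eq_inner]
  rw [G.form_averageL2_comm hs hψ hφ]

/-- `A` is a `Q`-orthogonal projection on finitely supported functions, so `0 ≤ Q(φ - Aφ, φ - Aφ) =
Q(φ, φ) - Q(Aφ, Aφ)`. -/
theorem form_averageL2_le (hs : G.PreservesSymmetry x₀) {φ : G.L2} (hφ : φ ∈ G.finSupp) :
    G.form (G.averageL2 x₀ φ) (G.averageL2 x₀ φ) ≤ G.form φ φ := by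
  have hA := G.averageL2_mem_finSupp x₀ hφ
  have h1 := G.form_self_nonneg ((φ - G.averageL2 x₀ φ : G.L2) : V → ℝ)
  have hd := G.finSupp.sub_mem hφ hA
  have h2 : ∀ ψ : G.L2, ψ ∈ G.finSupp →
      G.form ((φ - G.averageL2 x₀ φ : G.L2) : V → ℝ) ψ
        = G.form φ ψ - G.form (G.averageL2 x₀ φ) ψ := by
    intro ψ hψ
    rw [form_eq_inner _ _ hψ, form_eq_inner _ _ hψ, form_eq_inner _ _ hψ, inner_sub_left]
  rw [h2 _ hd, form_comm, h2 _ hφ, G.form_comm (G.averageL2 x₀ φ : V → ℝ)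
    ((φ - G.averageL2 x₀ φ : G.L2) : V → ℝ), h2 _ hA, ← G.form_averageL2_comm hs hφ hφ,
    G.form_averageL2_left hs hφ] at h1
  linarith

/-- Averaging contracts the energy norm on finitely supported functions, so the averages of an
approximating sequence are Cauchy. Their limit is identified through its `ℓ²` component. -/
theorem averageL2_mem_formDomain (hs : G.PreservesSymmetry x₀) {f : G.L2}
    (hf : f ∈ G.formDomain) : G.averageL2 x₀ f ∈ G.formDomain := by
  obtain ⟨hf1, hf2⟩ := G.mem_formDomain_iff.1 hf
  obtain ⟨u, hu, hlim⟩ := mem_closure_iff_seq_limit.1 hf2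
  choose φ' hφ' using hu
  have hφ : ∀ n, (φ' n).1 ∈ G.finSupp := fun n => (hφ' n).1
  let ψ : ℕ → G.energySpace := fun n =>
    ⟨G.averageL2 x₀ (φ' n).1, G.finSupp_le_energySpace (G.averageL2_mem_finSupp x₀ (hφ n))⟩
  have hle : ∀ n k, ‖G.energyGraph (ψ n) - G.energyGraph (ψ k)‖ ≤ ‖u n - u k‖ := by
    intro n k
    refine (sq_le_sq₀ (norm_nonneg _) (norm_nonneg _)).1 ?_
    have e : (ψ n - ψ k : G.energySpace).1 = G.averageL2 x₀ ((φ' n).1 - (φ' k).1) :=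
      (map_sub (G.averageCLM x₀) (φ' n).1 (φ' k).1).symm
    rw [← (hφ' n).2, ← (hφ' k).2, ← map_sub, ← map_sub, norm_sq_energyGraph,
      norm_sq_energyGraph, e]
    refine add_le_add ?_ (G.form_averageL2_le hs (G.finSupp.sub_mem (hφ n) (hφ k)))
    exact pow_le_pow_left₀ (norm_nonneg _) (G.norm_averageL2_le x₀ _) 2
  have hc : CauchySeq fun n => G.energyGraph (ψ n) := by
    rw [Metric.cauchySeq_iff]
    intro ε hε
    obtain ⟨N, hN⟩ := Metric.cauchySeq_iff.1 hlim.cauchySeq ε hε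
    refine ⟨N, fun n hn k hk => ?_⟩
    have h1 := hN n hn k hk
    rw [dist_eq_norm] at h1 ⊢
    exact (hle n k).trans_lt h1
  obtain ⟨v, hv⟩ := cauchySeq_tendsto_of_complete hc
  have hvm : v ∈ G.formSpace := G.isClosed_formSpace.mem_of_tendsto hv <|
    Eventually.of_forall fun n =>
      G.energyGraph_mem_formSpace (G.averageL2_mem_finSupp x₀ (hφ n))
  obtain ⟨w, rfl⟩ := G.eq_energyGraph_of_mem hvm
  have h1 : Tendsto (fun n => G.averageL2 x₀ (φ' n).1) atTop (𝓝 w.1) :=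
    (G.energyFst.continuous.tendsto _).comp hv
  have h2 : Tendsto (fun n => (φ' n).1) atTop (𝓝 f) := by
    refine ((G.energyFst.continuous.tendsto _).comp hlim).congr fun n => ?_
    rw [Function.comp_apply, ← (hφ' n).2, energyFst_energyGraph]
  have h3 : w.1 = G.averageL2 x₀ f :=
    tendsto_nhds_unique h1 (((G.averageCLM x₀).continuous.tendsto _).comp h2)
  rw [← h3]
  exact G.mem_formDomain_of_mem_formSpace w.2 hvm

/-- Tested against `φ`: `⟨Af, Lφ⟩ = ⟨f, L A φ⟩ = ⟨g, Aφ⟩ = ⟨Ag, φ⟩`, where `Aφ` is again an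
admissible test function. -/
theorem isLaplacian_averageL2 (hs : G.PreservesSymmetry x₀) {f g : G.L2}
    (h : G.IsLaplacian f g) : G.IsLaplacian (G.averageL2 x₀ f) (G.averageL2 x₀ g) := by
  rw [isLaplacian_iff] at h ⊢
  refine ⟨G.averageL2_mem_formDomain hs h.1, fun φ hφ => ?_⟩
  rw [inner_averageL2_left, inner_averageL2_left, G.averageL2_laplacianL2 hs hφ]
  exact h.2 _ _

/-! ### The two implications -/

theorem heatKernelIsSphericallySymmetric (h : G.IsWeaklySphericallySymmetric) :
    G.HeatKernelIsSphericallySymmetric := by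
  obtain ⟨x₀, hout, hin, hq⟩ := h
  have hs : G.PreservesSymmetry x₀ := fun f hf =>
    G.isSphericallySymmetric_formalLaplacian hout hin hq hf
  refine ⟨x₀, _, G.isHeatSemigroup_semigroup, fun t f => ?_⟩
  exact G.isMaximalMonotone_laplacianGraph.semigroup_comm (C := G.averageCLM x₀)
    (fun f g hfg => G.isLaplacian_averageL2 hs hfg) t f

/-- If averaging commutes with the semigroup, then it commutes with the generator. -/
theorem IsHeatSemigroup.isLaplacian_averageL2 {T : ℝ≥0 → G.L2 →L[ℝ] G.L2}
    (hT : G.IsHeatSemigroup T)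
    (hA : ∀ (t : ℝ≥0) (f : G.L2), G.averageL2 x₀ (T t f) = T t (G.averageL2 x₀ f)) {f g : G.L2}
    (h : G.IsLaplacian f g) : G.IsLaplacian (G.averageL2 x₀ f) (G.averageL2 x₀ g) := by
  rw [← hT.generator] at h ⊢
  refine (((G.averageCLM x₀).continuous.tendsto _).comp h).congr fun t => ?_
  rw [Function.comp_apply, map_smul, map_sub, averageCLM_apply, averageCLM_apply, hA]

theorem IsLaplacian.unique {f g g' : G.L2} (h : G.IsLaplacian f g) (h' : G.IsLaplacian f g') :
    g = g' := by
  refine G.eq_of_inner_finSupp fun φ hφ => ?_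
  rw [← h.2 φ (G.finSupp_subset_formDomain hφ), h'.2 φ (G.finSupp_subset_formDomain hφ)]

theorem isWeaklySphericallySymmetric (h : G.HeatKernelIsSphericallySymmetric) :
    G.IsWeaklySphericallySymmetric := by
  obtain ⟨x₀, T, hT, hA⟩ := h
  refine G.isWeaklySphericallySymmetric_of_formalLaplacian (x₀ := x₀) fun r => ?_
  have hfin : (Function.support fun y => if G.dist x₀ y = r then (1 : ℝ) else 0).Finite :=
    (G.sphere_finite x₀ r).subset fun y hy => by
      by_contra hne
      exact hy (if_neg hne)
  -- The indicator of a sphere is in `D(L)` and fixed by `A`. Hence both `Lφ` and `A L φ` are values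
  -- of `L` at `φ`, and uniqueness makes `Lφ` symmetric.
  let φ : G.L2 := ⟨_, G.mem_ellTwo_of_finite_support hfin⟩
  have hφ : φ ∈ G.finSupp := hfin
  have hAφ : G.averageL2 x₀ φ = φ := G.averageL2_eq_self <|
    G.isSphericallySymmetric_iff.2 fun x y hxy => by
      change (if _ then _ else _) = (if _ then _ else _)
      rw [hxy]
  have h1 := G.isLaplacian_of_mem_finSupp hφ
  have h2 := IsHeatSemigroup.isLaplacian_averageL2 G hT hA h1
  rw [hAφ] at h2
  have h3 : G.averageL2 x₀ (G.laplacianL2 φ hφ) = G.laplacianL2 φ hφ :=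
    IsLaplacian.unique G h2 h1
  have h4 : G.average x₀ (G.formalLaplacian φ) = G.formalLaplacian φ := congrArg Subtype.val h3
  have h5 := G.isSphericallySymmetric_average x₀ (G.formalLaplacian φ)
  rw [h4] at h5
  exact h5

end WeightedGraph
end

theorem theoremt {V : Type*} [Countable V] (G : WeightedGraph V) :
    G.IsWeaklySphericallySymmetric ↔ G.HeatKernelIsSphericallySymmetric :=
  ⟨G.heatKernelIsSphericallySymmetric, G.isWeaklySphericallySymmetric⟩
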